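/- Let $k$ be a field, $S=k[x_1,\dots,x_n]$ with the standard grading, $\mathfrak m=(x_1,\dots,x_n)$, and let $M$ be a $\mathbb Z$-graded $S$-module with a surjection $\eta:\bigoplus_j S\,g_j\to M$ from a free module with finite basis $(g_j)$, where every $\eta(g_j)$ is homogeneous of degree $\deg g_j$. Let $\prec$ be a term order on $\bigoplus_j S g_j$ and suppose that the presentation has *initially linear syzygies* with respect to $\prec$: $\ker\eta\subseteq\bigoplus_j\mathfrak m g_j$, and the initial module $\mathrm{in}_\prec(\ker\eta)$ is generated by terms of the form $x_ig_j$. Put $\mathrm{crit}(g_j)=\{i\mid x_ig_j\in\mathrm{in}_\prec(\ker\eta)\}$ and $\mathrm{ncrit}(g_j)=[n]\setminus\mathrm{crit}(g_j)$. For $i\in[n]$ and $I\subseteq[n]$ let $\mathrm{sgn}(i,I)=(-1)^{|\{l\in I\,:\,l<i\}|}$. The *two-sided Koszul complex* $F$ of $M$ has $F_p=S\otimes_k\Lambda^pV\otimes_kM$, where $V=k^n$ has basis $e_1,\dots,e_n$; with $e_I=e_{i_1}\wedge\dots\wedge e_{i_p}$ for $I=\{i_1<\dots<i_p\}$ and $e_Im=1\otimes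 e_I\otimes m$, its $S$-linear differential is $$d_F(e_Im)=\sum_{i\in I}\mathrm{sgn}(i,I)\,\bigl(x_i\,e_{I\setminus i}m-e_{I\setminus i}\,x_im\bigr).$$ Then the following hold. 1. $F$, with augmentation $s\otimes m\mapsto sm$, is a free resolution of $M$. 2. The elements $x^\alpha g_j:=\eta(x^\alpha g_j)$ with $\mathrm{supp}\,\alpha\subseteq\mathrm{ncrit}(g_j)$ form a $k$-basis of $M$. Hence the $e_Ix^\alpha g_j$ with $\mathrm{supp}\,\alpha\subseteq\mathrm{ncrit}(g_j)$ form an $S$-basis of $F$. 3. View $F$ as a based complex of $S$-modules with summands $S\cdot e_Ix^\alpha g_j$. The set $E$ of all edges $$S\cdot e_Ix^\alpha g_j\to S\cdot e_{I\setminus i}\,x_ix^\alpha g_j,\qquad i=\max\bigl((I\cup\mathrm{supp}\,\alpha)\cap\mathrm{ncrit}(g_j)\bigr)\in I,$$ is a Morse matching on the digraph of $F$, that is: the digraph has an edge $v\to w$ whenever the component of $d_F$ from $v$ to $w$ is nonzero; $E$ consists of edges of it, no vertex is incident to more than one edge of $E$, the components of $d_F$ along the edges of $E$ are isomorphisms,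 and for each $p$ there is a well-founded strict partial order $<$ on the vertices of homological degree $p$ such that $w<u$ whenever, after reversing the edges of $E$, there is a path $u\to v\to w$ with $u,w$ in degree $p$. The unmatched vertices are exactly the $S\cdot e_Ig_j$ with $I\subseteq\mathrm{crit}(g_j)$. 4. There is exactly one family of $S$-linear maps $\phi:F_p\to F_{p+1}$, $p\ge 0$, such that for all basis elements $v=e_Ix^\alpha g_j$, $\mathrm{supp}\,\alpha\subseteq\mathrm{ncrit}(g_j)$: if $\alpha\neq0$ and $\iota=\max(\mathrm{supp}\,\alpha)$ is larger than all elements of $I\cap\mathrm{ncrit}(g_j)$, then $$\phi(v)=\phi_0(v)-\phi\bigl(d_F\phi_0(v)-v\bigr),\qquad \phi_0(v)=-\,\mathrm{sgn}(\iota,I\cup\iota)\;e_{I\cup\iota}\,\frac{x^\alpha}{x_\iota}g_j,$$ and otherwise $\phi(v)=0$. 5. Let $G_p$ be the free $S$-module with basis the elements $e_Ig_j$ with $|I|=p$ and $I\subseteq\mathrm{crit}(g_j)$, regarded as a submodule of $F_p$; let $\pi:F_p\to G_p$ be the projection that sends all other basis elements $e_Ix^\alpha g_j$ to $0$, and put $d_G=\pi(d_F-d_F\phi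 d_F)$ on $G$. Then $G$, with differential $d_G$ and augmentation $e_\emptyset g_j\mapsto\eta(g_j)$, is the minimal graded free resolution of $M$: it is a resolution of $M$ by finitely generated free modules, its differential and augmentation are homogeneous of degree $0$ for $\deg(e_Ig_j)=|I|+\deg g_j$, and $d_G(G_{p+1})\subseteq\mathfrak mG_p$ for all $p\ge 0$. -/

import Mathlib

set_option maxSynthPendingDepth 3

open scoped TensorProduct

noncomputable section

namespace InitLin

/-- The polynomial ring `S = k[x_1, …, x_n]`. -/
abbrev Poly (k : Type*) [Field k] (n : ℕ) : Type _ := MvPolynomial (Fin n) k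

/-- The ideal `𝔪 = (x_1, …, x_n)` of `S`. -/
def irrelevant (k : Type*) [Field k] (n : ℕ) : Ideal (Poly k n) :=
  Ideal.span (Set.range MvPolynomial.X)

/-! ### Terms and term orders on a free module -/

/-- The terms `x^α g_j` of the free module `⨁_j S g_j`, encoded as pairs `(α, j)`. -/
abbrev Term (n : ℕ) (ι : Type*) : Type _ := (Fin n →₀ ℕ) × ι

/-- A term order on the free module with basis `(g_j)`: a strict total order on its terms that is
compatible with multiplication by monomials and for which `t ≼ x^γ t`. -/
structure TermOrder (n : ℕ) (ι : Type*) where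
  lt : Term n ι → Term n ι → Prop
  isStrictTotalOrder : IsStrictTotalOrder (Term n ι) lt
  mul_lt_mul : ∀ (γ : Fin n →₀ ℕ) (s t : Term n ι), lt s t → lt (γ + s.1, s.2) (γ + t.1, t.2)
  lt_mul : ∀ (γ : Fin n →₀ ℕ) (t : Term n ι), γ ≠ 0 → lt t (γ + t.1, t.2)

section Presentation

variable {k : Type*} [Field k] {n : ℕ} {ι : Type*}

/-- The term `x^α g_j` as an element of the free module. -/
def termVec (k : Type*) [Field k] {n : ℕ} {ι : Type*} (t : Term n ι) : ι →₀ Poly k n :=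
  Finsupp.single t.2 (MvPolynomial.monomial t.1 1)

/-- `t` is the initial (largest) term of the element `f` of the free module. -/
def IsInitialTerm (ord : TermOrder n ι) (f : ι →₀ Poly k n) (t : Term n ι) : Prop :=
  (f t.2).coeff t.1 ≠ 0 ∧ ∀ s : Term n ι, (f s.2).coeff s.1 ≠ 0 → s ≠ t → ord.lt s t

/-- The initial module `in_≺(K)`, generated by the initial terms of the nonzero elements of `K`. -/
def initialModule (ord : TermOrder n ι) (K : Submodule (Poly k n) (ι →₀ Poly k n)) :
    Submodule (Poly k n) (ι →₀ Poly k n) :=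
  Submodule.span (Poly k n) {v | ∃ f ∈ K, ∃ t, IsInitialTerm ord f t ∧ v = termVec k t}

variable {M : Type*} [AddCommGroup M] [Module k M] [Module (Poly k n) M]
  [IsScalarTower k (Poly k n) M]

/-- The presentation `η` has initially linear syzygies with respect to the term order `ord`:
`ker η ⊆ ⨁ 𝔪 g_j`, and `in(ker η)` is generated by terms of the form `x_i g_j`. -/
structure InitiallyLinear (ord : TermOrder n ι)
    (η : (ι →₀ Poly k n) →ₗ[Poly k n] M) : Prop where
  ker_le : LinearMap.ker η ≤
    irrelevant k n • (⊤ : Submodule (Poly k n) (ι →₀ Poly k n))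
  linear : ∃ A : Set (Fin n × ι), initialModule ord (LinearMap.ker η) =
    Submodule.span (Poly k n) ((fun a => termVec k (Finsupp.single a.1 1, a.2)) '' A)

/-- The set `crit(g_j)` of critical indices of the basis element `g_j`; its complement is
`ncrit(g_j)`. -/
def crit (ord : TermOrder n ι) (η : (ι →₀ Poly k n) →ₗ[Poly k n] M) (j : ι) : Set (Fin n) :=
  {i | termVec k (Finsupp.single i 1, j) ∈ initialModule ord (LinearMap.ker η)}

/-- The terms `x^α g_j` with `supp α ⊆ ncrit(g_j)`. -/
def StdTerm (ord : TermOrder n ι) (η : (ι →₀ Poly k n) →ₗ[Poly k n] M) : Type _ :=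
  {t : Term n ι // ∀ i ∈ t.1.support, i ∉ crit ord η t.2}

/-- `ℳ` is a `ℤ`-grading of the `S`-module `M`, where `S` has the standard grading. -/
structure IsGrading (ℳ : ℤ → Submodule k M) : Prop where
  isInternal : DirectSum.IsInternal ℳ
  X_smul_mem : ∀ (d : ℤ) (i : Fin n) (m : M), m ∈ ℳ d →
    (MvPolynomial.X i : Poly k n) • m ∈ ℳ (d + 1)

end Presentation

/-! ### Resolutions -/

/-- The complex `⋯ → K 1 → K 0` with differentials `d p : K (p + 1) → K p`, together with the
augmentation `ε : K 0 → M`, is a free resolution of `M`. -/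
structure IsFreeResolution {R : Type*} [CommRing R] {M : Type*} [AddCommGroup M] [Module R M]
    {K : ℕ → Type*} [∀ p, AddCommGroup (K p)] [∀ p, Module R (K p)]
    (d : ∀ p, K (p + 1) →ₗ[R] K p) (ε : K 0 →ₗ[R] M) : Prop where
  free : ∀ p, Module.Free R (K p)
  surjective : Function.Surjective ε
  exact_zero : Function.Exact (d 0) ε
  exact_succ : ∀ p, Function.Exact (d (p + 1)) (d p)

/-- The complex of the free modules with finite bases `B p`, the basis element `b` having
degree `deg p b`, is a minimal graded free resolution of the graded module `M`. -/
structure IsMinimalGradedFreeResolution {k : Type*} [Field k] {n : ℕ} {M : Type*}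
    [AddCommGroup M] [Module k M] [Module (Poly k n) M] (ℳ : ℤ → Submodule k M)
    {B : ℕ → Type*} (deg : ∀ p, B p → ℤ)
    (d : ∀ p, (B (p + 1) →₀ Poly k n) →ₗ[Poly k n] (B p →₀ Poly k n))
    (ε : (B 0 →₀ Poly k n) →ₗ[Poly k n] M) : Prop where
  isFreeResolution : IsFreeResolution (R := Poly k n) (K := fun p => B p →₀ Poly k n) d ε
  finite : ∀ p, Finite (B p)
  /-- The augmentation is homogeneous of degree `0`. -/
  homogeneous_aug : ∀ b, ε (Finsupp.single b 1) ∈ ℳ (deg 0 b)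
  /-- The differentials are homogeneous of degree `0`. -/
  homogeneous : ∀ p b c, d p (Finsupp.single b 1) c ≠ 0 →
    ∃ a : ℕ, (d p (Finsupp.single b 1) c).IsHomogeneous a ∧ (a : ℤ) + deg p c = deg (p + 1) b
  minimal : ∀ p, LinearMap.range (d p) ≤
    irrelevant k n • (⊤ : Submodule (Poly k n) (B p →₀ Poly k n))

/-! ### Algebraic Morse matchings on complexes of based free modules -/

section Morse

variable {R : Type*} [CommRing R] {K : ℕ → Type*} [∀ p, AddCommGroup (K p)] [∀ p, Module R (K p)]
  {V : ℕ → Type*}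

/-- The edges of the digraph of a based complex whose summands are the free modules `R · v`,
`v ∈ V p`: there is an edge whenever the corresponding component of the differential is nonzero. -/
inductive Edge (d : ∀ p, K (p + 1) →ₗ[R] K p) (bas : ∀ p, Module.Basis (V p) R (K p)) :
    (Σ p, V p) → (Σ p, V p) → Prop
  | mk (p : ℕ) (v : V (p + 1)) (w : V p) (h : (bas p).repr (d p (bas (p + 1) v)) w ≠ 0) :
      Edge d bas ⟨p + 1, v⟩ ⟨p, w⟩

/-- The edges of the digraph obtained by reversing the edges in `A`. -/
def MorseEdge (d : ∀ p, K (p + 1) →ₗ[R] K p) (bas : ∀ p, Module.Basis (V p) R (K p))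
    (A : (Σ p, V p) → (Σ p, V p) → Prop) (v w : Σ p, V p) : Prop :=
  (Edge d bas v w ∧ ¬ A v w) ∨ A w v

/-- `A` is a Morse matching on the based complex. Each summand is free of rank one, so a component
of the differential is an isomorphism exactly if its coefficient is a unit. -/
structure IsMorseMatching (d : ∀ p, K (p + 1) →ₗ[R] K p)
    (bas : ∀ p, Module.Basis (V p) R (K p)) (A : (Σ p, V p) → (Σ p, V p) → Prop) : Prop where
  edge : ∀ v w, A v w → Edge d bas v w
  /-- No vertex is incident to more than one edge in `A`. -/
  matching : ∀ v w v' w', A v w → A v' w' → (v = v' ∨ v = w' ∨ w = v' ∨ w = w') →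
    v = v' ∧ w = w'
  isUnit : ∀ p (v : V (p + 1)) (w : V p), A ⟨p + 1, v⟩ ⟨p, w⟩ →
    IsUnit ((bas p).repr (d p (bas (p + 1) v)) w)
  wellFounded : ∀ p, ∃ lt : V p → V p → Prop, IsStrictOrder (V p) lt ∧ WellFounded lt ∧
    ∀ (u w : V p) (v : Σ q, V q),
      MorseEdge d bas A ⟨p, u⟩ v → MorseEdge d bas A v ⟨p, w⟩ → lt w u

/-- The vertex `v` is not incident to an edge in `A`. -/
def IsUnmatched (A : (Σ p, V p) → (Σ p, V p) → Prop) (v : Σ p, V p) : Prop :=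
  ∀ w, ¬ A v w ∧ ¬ A w v

end Morse

/-! ### The two-sided Koszul complex -/

/-- `sgn(i, I) = (-1) ^ #{j ∈ I | j < i}`. -/
def sgn {n : ℕ} (i : Fin n) (I : Finset (Fin n)) : ℤ := (-1) ^ (I.filter (· < i)).card

section Koszul

variable (k : Type*) [Field k] (n : ℕ) (M : Type*) [AddCommGroup M] [Module k M]

/-- The module `F_p = S ⊗ Λ^p V ⊗ M`, where `V = k^n`, written through the basis
`e_I`, `|I| = p`, of `Λ^p V` as the direct sum of copies of `S ⊗ M` indexed by these `I`;
`S` acts on the left factor. -/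
abbrev Koszul (p : ℕ) : Type _ :=
  {I : Finset (Fin n) // I.card = p} →₀ (Poly k n ⊗[k] M)

/-- The inclusion `s ⊗ m ↦ s ⊗ e_I ⊗ m` of `S ⊗ M` into `F_p`, for `|I| = p` (and the zero map
for other `I`). -/
def inclE (p : ℕ) (I : Finset (Fin n)) :
    (Poly k n ⊗[k] M) →ₗ[Poly k n] Koszul k n M p :=
  if h : I.card = p then Finsupp.lsingle ⟨I, h⟩ else 0

variable {M} in
/-- The element `e_I m = 1 ⊗ e_I ⊗ m` of `F_p`, for `|I| = p`. -/
def elemE (p : ℕ) (I : Finset (Fin n)) (m : M) : Koszul k n M p :=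
  inclE k n M p I (1 ⊗ₜ[k] m)

variable [Module (Poly k n) M] [IsScalarTower k (Poly k n) M]

/-- The `S`-linear map `s ⊗ m ↦ s ⊗ x_i m`. -/
def rightMul (i : Fin n) : (Poly k n ⊗[k] M) →ₗ[Poly k n] (Poly k n ⊗[k] M) :=
  LinearMap.baseChange (Poly k n)
    ((LinearMap.lsmul (Poly k n) M (MvPolynomial.X i)).restrictScalars k)

/-- The differential
`d (e_I m) = ∑_{i ∈ I} sgn(i, I) (x_i e_{I ∖ i} m - e_{I ∖ i} x_i m)`. -/
def koszulD (p : ℕ) : Koszul k n M (p + 1) →ₗ[Poly k n] Koszul k n M p :=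
  Finsupp.lsum (Poly k n) fun I => ∑ i ∈ I.1,
    sgn i I.1 • (inclE k n M p (I.1.erase i) ∘ₗ
      ((MvPolynomial.X i : Poly k n) • LinearMap.id - rightMul k n M i))

/-- The augmentation `F_0 = S ⊗ M → M`, `s ⊗ m ↦ s m`. -/
def koszulAug : Koszul k n M 0 →ₗ[Poly k n] M :=
  Finsupp.lsum (Poly k n) fun _ =>
    TensorProduct.AlgebraTensorModule.lift
      ((LinearMap.toSpanSingleton (Poly k n) (M →ₗ[k] M)
        LinearMap.id))

end Koszul

section Main

variable {k : Type*} [Field k] {n : ℕ} {ι : Type*} {M : Type*} [AddCommGroup M] [Module k M]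
  [Module (Poly k n) M] [IsScalarTower k (Poly k n) M]

/-- The vertices `S · e_I x^α g_j` in degree `p`: `|I| = p` and `supp α ⊆ ncrit(g_j)`. -/
abbrev Vertex (ord : TermOrder n ι) (η : (ι →₀ Poly k n) →ₗ[Poly k n] M) (p : ℕ) : Type _ :=
  Σ _ : {I : Finset (Fin n) // I.card = p}, StdTerm ord η

/-- The `S`-basis `e_I b_t` of `F_p` given by a `k`-basis `b` of `M`. -/
def koszulBasis {T : Type*} (b : Module.Basis T k M) (p : ℕ) :
    Module.Basis (Σ _ : {I : Finset (Fin n) // I.card = p}, T) (Poly k n) (Koszul k n M p) :=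
  Finsupp.basis fun _ => Algebra.TensorProduct.basis (Poly k n) b

/-- The matching `E` of all edges `e_I x^α g_j → e_{I ∖ i} x_i x^α g_j` with
`i = max ((I ∪ supp α) ∩ ncrit g_j)`. -/
inductive Matching (ord : TermOrder n ι) (η : (ι →₀ Poly k n) →ₗ[Poly k n] M) :
    (Σ p, Vertex ord η p) → (Σ p, Vertex ord η p) → Prop
  | mk (p : ℕ) (v : Vertex ord η (p + 1)) (w : Vertex ord η p) (i : Fin n) (hi : i ∈ v.1.1)
      (hmax : IsGreatest (((v.1.1 ∪ v.2.1.1.support : Finset (Fin n)) : Set (Fin n)) ∩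
        (crit ord η v.2.1.2)ᶜ) i)
      (hI : w.1.1 = v.1.1.erase i)
      (ht : w.2.1 = (v.2.1.1 + Finsupp.single i 1, v.2.1.2)) :
      Matching ord η ⟨p + 1, v⟩ ⟨p, w⟩

/-- The condition `i = ι(α) > max (I ∩ ncrit g_j)`, where `ι(α) = max (supp α)` (in particular
`α ≠ 0`). -/
def IsLiftIndex (ord : TermOrder n ι) (η : (ι →₀ Poly k n) →ₗ[Poly k n] M)
    (I : Finset (Fin n)) (t : Term n ι) (i : Fin n) : Prop :=
  IsGreatest (t.1.support : Set (Fin n)) i ∧ ∀ l ∈ I, l ∉ crit ord η t.2 → l < i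

/-- The nonzero value `φ₀(e_I x^α g_j) = - sgn(i, I ∪ i) e_{I ∪ i} (x^α / x_i) g_j`, for
`i = ι(α) > max (I ∩ ncrit g_j)`. -/
def phiZero (η : (ι →₀ Poly k n) →ₗ[Poly k n] M) (p : ℕ)
    (I : Finset (Fin n)) (t : Term n ι) (i : Fin n) : Koszul k n M (p + 1) :=
  -(sgn i (insert i I) •
    elemE k n (p + 1) (insert i I) (η (termVec k (t.1 - Finsupp.single i 1, t.2))))

/-- The recursion that defines the `S`-linear homotopy `φ`: for `v = e_I x^α g_j`, with
`supp α ⊆ ncrit(g_j)`, one has `φ v = φ₀ v - φ (d (φ₀ v) - v)` if `ι(α) > max (I ∩ ncrit g_j)`,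
and `φ v = 0` otherwise. -/
structure IsMorseHomotopy (ord : TermOrder n ι) (η : (ι →₀ Poly k n) →ₗ[Poly k n] M)
    (φ : ∀ p, Koszul k n M p →ₗ[Poly k n] Koszul k n M (p + 1)) : Prop where
  rec_eq : ∀ (p : ℕ) (I : Finset (Fin n)) (t : StdTerm ord η) (i : Fin n), I.card = p →
    IsLiftIndex ord η I t.1 i →
    φ p (elemE k n p I (η (termVec k t.1))) =
      phiZero η p I t.1 i -
        φ p (koszulD k n M p (phiZero η p I t.1 i) - elemE k n p I (η (termVec k t.1)))
  eq_zero : ∀ (p : ℕ) (I : Finset (Fin n)) (t : StdTerm ord η), I.card = p →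
    (¬ ∃ i, IsLiftIndex ord η I t.1 i) →
    φ p (elemE k n p I (η (termVec k t.1))) = 0

/-- The basis elements `e_I g_j` of `G_p`: `|I| = p` and `I ⊆ crit(g_j)`. -/
def CritCell (ord : TermOrder n ι) (η : (ι →₀ Poly k n) →ₗ[Poly k n] M) (p : ℕ) : Type _ :=
  {c : Finset (Fin n) × ι // c.1.card = p ∧ ∀ i ∈ c.1, i ∈ crit ord η c.2}

/-- The inclusion `G_p → F_p`. -/
def inclG (ord : TermOrder n ι) (η : (ι →₀ Poly k n) →ₗ[Poly k n] M) (p : ℕ) :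
    (CritCell ord η p →₀ Poly k n) →ₗ[Poly k n] Koszul k n M p :=
  Finsupp.linearCombination (Poly k n) fun c => elemE k n p c.1.1 (η (Finsupp.single c.1.2 1))

open Classical in
/-- The projection `π : F_p → G_p` along the basis `e_I x^α g_j` of `F_p`; here `b` is the
`k`-basis `x^α g_j`, `supp α ⊆ ncrit(g_j)`, of `M`. -/
def projG (ord : TermOrder n ι) (η : (ι →₀ Poly k n) →ₗ[Poly k n] M)
    (b : Module.Basis (StdTerm ord η) k M) (p : ℕ) :
    Koszul k n M p →ₗ[Poly k n] (CritCell ord η p →₀ Poly k n) :=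
  (koszulBasis b p).constr (Poly k n) fun v =>
    if h : v.2.1.1 = 0 ∧ ∀ i ∈ v.1.1, i ∈ crit ord η v.2.1.2 then
      Finsupp.single ⟨(v.1.1, v.2.1.2), v.1.2, h.2⟩ 1
    else 0

/-- The differential `d_G = π (d_F - d_F φ d_F)` of `G`. -/
def diffG (ord : TermOrder n ι) (η : (ι →₀ Poly k n) →ₗ[Poly k n] M)
    (b : Module.Basis (StdTerm ord η) k M)
    (φ : ∀ p, Koszul k n M p →ₗ[Poly k n] Koszul k n M (p + 1)) (p : ℕ) :
    (CritCell ord η (p + 1) →₀ Poly k n) →ₗ[Poly k n] (CritCell ord η p →₀ Poly k n) :=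
  projG ord η b p ∘ₗ
    (koszulD k n M p - koszulD k n M p ∘ₗ φ p ∘ₗ koszulD k n M p) ∘ₗ inclG ord η (p + 1)

/-- The augmentation `G_0 → M`, `e_∅ g_j ↦ η(g_j)`. -/
def augG (ord : TermOrder n ι) (η : (ι →₀ Poly k n) →ₗ[Poly k n] M) :
    (CritCell ord η 0 →₀ Poly k n) →ₗ[Poly k n] M :=
  Finsupp.linearCombination (Poly k n) fun c => η (Finsupp.single c.1.2 1)

/-- The internal degree `|I| + deg g_j` of `e_I g_j`. -/
def degG (ord : TermOrder n ι) (η : (ι →₀ Poly k n) →ₗ[Poly k n] M) (deg : ι → ℤ) (p : ℕ)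
    (c : CritCell ord η p) : ℤ :=
  (p : ℤ) + deg c.1.2

end Main

end InitLin

end

set_option linter.unusedSectionVars false

noncomputable section

namespace InitLin

/-! `F` is contracted by hand and then reduced by algebraic Morse theory.

Exactness of `F`. Replacing the left variables of `S ⊗ S` one by one by the right ones changes an
element by multiples of `x_i ⊗ 1 - 1 ⊗ x_i`. The quotients are divided differences, and the sum over
`i < min I` of `e_{I ∪ i}` times the `i`th divided difference is a contracting homotopy
(`koszulD_koszulH_zero`, `koszulD_koszulH_add`): one half of the computation telescopes, the other
cancels by commutation rules.

Basis of `M`. This is Macaulay's theorem: the standard terms are those outside the initial module.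
Reduction terminates because term orders are well-founded (`apply_termVec_mem_span_aux`), and a
relation among standard terms would be a syzygy with standard initial term.

Matching. An edge of `E` moves the largest noncritical index `i` from `I` into `α`, so either end
determines `i`. The term `x^I x^α g_j` is constant along `E` and never increases along an edge of
the digraph (`edge_cases`). When it stays the same, a zigzag exchanges some `l` for a larger `i` and
raises the sum of `I`. This gives the well-founded order `vtxLT`, along which `φ` is defined, shown
to be unique and analysed.

Reduction. Let `D` be spanned by the upper ends of `E`. Then `φ` inverts `d` on `D` and vanishes on
`D` and `G`, and `F_p = D_p + G_p + d D_{p+1}`. Hence `g ↦ g - φ d g` is a chain map from `G` to `F`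
through which exactness passes to `G` (`IsMorseSplitting.isFreeResolution`). All maps preserve the
internal degree. Minimality holds because `ker η ⊆ ⨁ 𝔪 g_j` prevents a bare `g_j` from occurring in
the expansion of `x_i m`. -/

/-! ### Divided differences -/

section DividedDifference

variable (k : Type*) [Field k] (n : ℕ)

/-- The algebra homomorphism `S → S ⊗ S` that sends `x_l` to `1 ⊗ x_l` for `l < i` and to
`x_l ⊗ 1` for the other `l`. -/
def mixSubst (i : ℕ) : Poly k n →ₐ[k] (Poly k n ⊗[k] Poly k n) :=
  MvPolynomial.aeval fun l => if (l : ℕ) < i then 1 ⊗ₜ MvPolynomial.X l else MvPolynomial.X l ⊗ₜ 1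

/-- The element `x_i ⊗ 1 - 1 ⊗ x_i`. -/
def diffX (i : Fin n) : Poly k n ⊗[k] Poly k n :=
  (MvPolynomial.X i : Poly k n) ⊗ₜ[k] (1 : Poly k n) - 1 ⊗ₜ MvPolynomial.X i

lemma mixSubst_X_of_lt {i : ℕ} {l : Fin n} (h : (l : ℕ) < i) :
    mixSubst k n i (MvPolynomial.X l) = 1 ⊗ₜ MvPolynomial.X l := by
  simp [mixSubst, h]

lemma mixSubst_X_of_le {i : ℕ} {l : Fin n} (h : i ≤ (l : ℕ)) :
    mixSubst k n i (MvPolynomial.X l) = MvPolynomial.X l ⊗ₜ 1 := by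
  simp [mixSubst, Nat.not_lt.mpr h]

/-- The two substitutions differ on the generator `x_i` only, by `diffX` itself. Products follow
from `a c - a' c' = (a - a') c + a' (c - c')`. -/
lemma diffX_dvd (i : Fin n) (f : Poly k n) :
    diffX k n i ∣ mixSubst k n i f - mixSubst k n (i + 1) f := by
  induction f using MvPolynomial.induction_on with
  | C a =>
    have h (j : ℕ) : mixSubst k n j (MvPolynomial.C a) = algebraMap k _ a :=
      (mixSubst k n j).commutes a
    simp [h]
  | add p q hp hq =>
    rw [map_add, map_add, add_sub_add_comm]
    exact dvd_add hp hq
  | mul_X p l hp =>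
    have hX : diffX k n i ∣
        mixSubst k n i (MvPolynomial.X l) - mixSubst k n (i + 1) (MvPolynomial.X l) := by
      rcases lt_trichotomy (l : ℕ) (i : ℕ) with h | h | h
      · rw [mixSubst_X_of_lt k n h, mixSubst_X_of_lt k n (by omega)]; simp
      · rw [mixSubst_X_of_le k n h.ge, mixSubst_X_of_lt k n (by omega)]
        rw [Fin.ext h]; exact dvd_refl _
      · rw [mixSubst_X_of_le k n h.le, mixSubst_X_of_le k n (by omega)]; simp
    rw [map_mul, map_mul]
    have := dvd_add (hp.mul_right (mixSubst k n i (MvPolynomial.X l)))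
      (hX.mul_left (mixSubst k n (i + 1) p))
    convert this using 1
    ring

/-- `S ⊗ S` is a polynomial ring over its left factor, hence a domain, and `diffX` has coefficient
`-1` at the variable `x_i`. -/
lemma diffX_mul_injective (i : Fin n) : Function.Injective (diffX k n i * ·) := by
  let e := MvPolynomial.algebraTensorAlgEquiv (σ := Fin n) k (Poly k n)
  intro a b hab
  apply e.injective
  have h : e (diffX k n i) * e a = e (diffX k n i) * e b := by
    rw [← map_mul, ← map_mul]; exact congrArg e hab
  refine mul_left_cancel₀ ?_ h
  intro h0
  have := congrArg (MvPolynomial.coeff (Finsupp.single i 1)) h0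
  have h00 : (0 : Fin n →₀ ℕ) ≠ Finsupp.single i 1 := fun h => by
    simpa using DFunLike.congr_fun h i
  simp [e, diffX, MvPolynomial.coeff_X, MvPolynomial.algebraTensorAlgEquiv_tmul,
    h00, MvPolynomial.coeff_one] at this

/-- The divided difference of `f` in the `i`th variable, when the earlier variables have already
been moved to the right factor. -/
def divDiff (i : Fin n) : Poly k n →ₗ[k] (Poly k n ⊗[k] Poly k n) where
  -- The quotient is unique by `diffX_mul_injective`, so it inherits linearity from the difference
  -- of the two substitutions.
  toFun f := (diffX_dvd k n i f).choose
  map_add' f g := diffX_mul_injective k n i <| by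
    have h (f) := (diffX_dvd k n i f).choose_spec.symm
    simp only [mul_add, h]
    rw [map_add, map_add]; abel
  map_smul' c f := diffX_mul_injective k n i <| by
    have h (f) := (diffX_dvd k n i f).choose_spec.symm
    simp only [mul_smul_comm, h, RingHom.id_apply]
    rw [map_smul, map_smul, smul_sub]

lemma diffX_mul_divDiff (i : Fin n) (f : Poly k n) :
    diffX k n i * divDiff k n i f = mixSubst k n i f - mixSubst k n (i + 1) f :=
  (diffX_dvd k n i f).choose_spec.symm

/-- Both substitutions treat `x_l` alike for `l ≠ i`, so `x_l` acts as a scalar: from the left if it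
has not been moved yet, from the right otherwise. -/
lemma divDiff_X_mul_of_lt {i l : Fin n} (h : i < l) (f : Poly k n) :
    divDiff k n i (MvPolynomial.X l * f) = (MvPolynomial.X l ⊗ₜ 1) * divDiff k n i f := by
  apply diffX_mul_injective k n i
  simp only
  rw [mul_left_comm, diffX_mul_divDiff, diffX_mul_divDiff, map_mul, map_mul,
    mixSubst_X_of_le k n (by omega), mixSubst_X_of_le k n (by omega), mul_sub]

lemma divDiff_X_mul_of_gt {i l : Fin n} (h : l < i) (f : Poly k n) :
    divDiff k n i (MvPolynomial.X l * f) = (1 ⊗ₜ MvPolynomial.X l) * divDiff k n i f := by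
  apply diffX_mul_injective k n i
  simp only
  rw [mul_left_comm, diffX_mul_divDiff, diffX_mul_divDiff, map_mul, map_mul,
    mixSubst_X_of_lt k n (by omega), mixSubst_X_of_lt k n (by omega), mul_sub]

/-- A twisted Leibniz rule. Its extra term `mixSubst` is what turns the divided differences into a
homotopy. -/
lemma divDiff_X_mul_self (i : Fin n) (f : Poly k n) :
    divDiff k n i (MvPolynomial.X i * f) =
      (1 ⊗ₜ MvPolynomial.X i) * divDiff k n i f + mixSubst k n i f := by
  apply diffX_mul_injective k n i
  simp only
  rw [mul_add, mul_left_comm, diffX_mul_divDiff, diffX_mul_divDiff, map_mul, map_mul,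
    mixSubst_X_of_le k n le_rfl, mixSubst_X_of_lt k n (by omega), diffX]
  ring

end DividedDifference

/-! ### Operators on `S ⊗ M` -/

section Operators

variable (k : Type*) [Field k] (n : ℕ) (M : Type*) [AddCommGroup M] [Module k M]
  [Module (Poly k n) M] [IsScalarTower k (Poly k n) M]

/-- The map `(s ⊗ s', m) ↦ s ⊗ s' m`. -/
def tensorAct : (Poly k n ⊗[k] Poly k n) →ₗ[k] M →ₗ[k] (Poly k n ⊗[k] M) :=
  TensorProduct.lift <| LinearMap.mk₂ k
    (fun s s' => TensorProduct.mk k (Poly k n) M s ∘ₗ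
      (LinearMap.lsmul (Poly k n) M s').restrictScalars k)
    (fun s₁ s₂ s' => by ext; simp)
    (fun c s s' => by ext; simp [TensorProduct.smul_tmul'])
    (fun s s₁ s₂ => by ext; simp [TensorProduct.tmul_add])
    (fun c s s' => by ext; simp)

@[simp] lemma tensorAct_tmul (s s' : Poly k n) (m : M) :
    tensorAct k n M (s ⊗ₜ s') m = s ⊗ₜ (s' • m) := rfl

/-- The operator `x_i ⊗ 1 - 1 ⊗ x_i` on `S ⊗ M`. -/
def diffOp (i : Fin n) : (Poly k n ⊗[k] M) →ₗ[Poly k n] (Poly k n ⊗[k] M) :=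
  (MvPolynomial.X i : Poly k n) • LinearMap.id - rightMul k n M i

lemma diffOp_tmul (i : Fin n) (s : Poly k n) (m : M) :
    diffOp k n M i (s ⊗ₜ m) =
      (MvPolynomial.X i * s) ⊗ₜ m - s ⊗ₜ ((MvPolynomial.X i : Poly k n) • m) := by
  simp [diffOp, rightMul, TensorProduct.smul_tmul']

lemma diffOp_tensorAct (i : Fin n) (t : Poly k n ⊗[k] Poly k n) (m : M) :
    diffOp k n M i (tensorAct k n M t m) = tensorAct k n M (diffX k n i * t) m := by
  induction t using TensorProduct.induction_on with
  | zero => simp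
  | tmul s s' =>
    simp [diffOp_tmul, diffX, sub_mul, Algebra.TensorProduct.tmul_mul_tmul, mul_smul]
  | add x y hx hy => simp [mul_add, hx, hy]

lemma tensorAct_smul (i : Fin n) (t : Poly k n ⊗[k] Poly k n) (m : M) :
    tensorAct k n M t ((MvPolynomial.X i : Poly k n) • m) =
      tensorAct k n M ((1 ⊗ₜ MvPolynomial.X i) * t) m := by
  induction t using TensorProduct.induction_on with
  | zero => simp
  | tmul s s' => simp [Algebra.TensorProduct.tmul_mul_tmul, smul_smul, mul_comm]
  | add x y hx hy => simp [mul_add, hx, hy]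

/-- The operator on `S ⊗ M` that moves the variables `x_l` with `l < i` to the right. -/
def moveOp (i : ℕ) : (Poly k n ⊗[k] M) →ₗ[k] (Poly k n ⊗[k] M) :=
  TensorProduct.lift (tensorAct k n M ∘ₗ (mixSubst k n i).toLinearMap)

/-- The divided difference operator on `S ⊗ M`. -/
def divOp (i : Fin n) : (Poly k n ⊗[k] M) →ₗ[k] (Poly k n ⊗[k] M) :=
  TensorProduct.lift (tensorAct k n M ∘ₗ divDiff k n i)

lemma moveOp_tmul (i : ℕ) (s : Poly k n) (m : M) :
    moveOp k n M i (s ⊗ₜ m) = tensorAct k n M (mixSubst k n i s) m := rfl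

lemma divOp_tmul (i : Fin n) (s : Poly k n) (m : M) :
    divOp k n M i (s ⊗ₜ m) = tensorAct k n M (divDiff k n i s) m := rfl

/-- This relation telescopes over `i`; the next three control the divided differences after the
Koszul differential. -/
lemma diffOp_divOp (i : Fin n) (f : Poly k n ⊗[k] M) :
    diffOp k n M i (divOp k n M i f) = moveOp k n M i f - moveOp k n M (i + 1) f := by
  induction f using TensorProduct.induction_on with
  | zero => simp
  | tmul s m => simp [divOp_tmul, moveOp_tmul, diffOp_tensorAct, diffX_mul_divDiff]
  | add x y hx hy => simp only [map_add, hx, hy]; abel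

lemma divOp_diffOp_self (i : Fin n) (f : Poly k n ⊗[k] M) :
    divOp k n M i (diffOp k n M i f) = moveOp k n M i f := by
  induction f using TensorProduct.induction_on with
  | zero => simp
  | tmul s m =>
    simp [divOp_tmul, moveOp_tmul, diffOp_tmul, divDiff_X_mul_self, tensorAct_smul]
  | add x y hx hy => simp only [map_add, hx, hy]

lemma divOp_diffOp_of_lt {i l : Fin n} (h : l < i) (f : Poly k n ⊗[k] M) :
    divOp k n M i (diffOp k n M l f) = 0 := by
  induction f using TensorProduct.induction_on with
  | zero => simp
  | tmul s m =>
    simp [divOp_tmul, diffOp_tmul, divDiff_X_mul_of_gt k n h, tensorAct_smul]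
  | add x y hx hy => simp only [map_add, hx, hy, add_zero]

lemma divOp_diffOp_of_gt {i l : Fin n} (h : i < l) (f : Poly k n ⊗[k] M) :
    divOp k n M i (diffOp k n M l f) = diffOp k n M l (divOp k n M i f) := by
  induction f using TensorProduct.induction_on with
  | zero => simp
  | tmul s m =>
    simp [divOp_tmul, diffOp_tmul, divDiff_X_mul_of_lt k n h, tensorAct_smul, diffOp_tensorAct,
      diffX, sub_mul]
  | add x y hx hy => simp only [map_add, hx, hy]

lemma diffOp_comm (i l : Fin n) (f : Poly k n ⊗[k] M) :
    diffOp k n M i (diffOp k n M l f) = diffOp k n M l (diffOp k n M i f) := by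
  induction f using TensorProduct.induction_on with
  | zero => simp
  | tmul s m =>
    simp only [diffOp_tmul, map_sub, mul_left_comm (MvPolynomial.X i : Poly k n),
      smul_comm (MvPolynomial.X i : Poly k n) (MvPolynomial.X l : Poly k n) m]
    abel
  | add x y hx hy => simp only [map_add, hx, hy]

lemma moveOp_zero (f : Poly k n ⊗[k] M) : moveOp k n M 0 f = f := by
  have h (s : Poly k n) : mixSubst k n 0 s = s ⊗ₜ 1 := by
    have : mixSubst k n 0 = Algebra.TensorProduct.includeLeft := by
      ext i; simp [mixSubst]
    rw [this]; rfl
  induction f using TensorProduct.induction_on with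
  | zero => simp
  | tmul s m => simp [moveOp_tmul, h]
  | add x y hx hy => simp only [map_add, hx, hy]

/-- At the far end of the telescope stands the augmentation followed by its section `m ↦ 1 ⊗ m`. -/
lemma moveOp_tmul_top (s : Poly k n) (m : M) : moveOp k n M n (s ⊗ₜ m) = 1 ⊗ₜ (s • m) := by
  have h : mixSubst k n n s = 1 ⊗ₜ s := by
    have : mixSubst k n n = Algebra.TensorProduct.includeRight := by
      ext i; simp [mixSubst]
    rw [this]; rfl
  simp [moveOp_tmul, h]

end Operators

/-! ### Signs -/

section Sign

variable {n : ℕ}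

lemma sgn_mul_self (i : Fin n) (I : Finset (Fin n)) : sgn i I * sgn i I = 1 := by
  rw [sgn, ← pow_add, ← two_mul, pow_mul]; simp

lemma sgn_insert_self (i : Fin n) (I : Finset (Fin n)) : sgn i (insert i I) = sgn i I := by
  simp [sgn, Finset.filter_insert]

lemma sgn_of_forall_lt {i : Fin n} {I : Finset (Fin n)} (h : ∀ l ∈ I, i < l) : sgn i I = 1 := by
  rw [sgn, Finset.filter_eq_empty_iff.mpr fun l hl => (h l hl).not_gt]; simp

lemma sgn_erase_of_le {i l : Fin n} {I : Finset (Fin n)} (h : i ≤ l) :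
    sgn i (I.erase l) = sgn i I := by
  rw [sgn, sgn, Finset.filter_erase, Finset.erase_eq_of_notMem]
  simp [h]

lemma sgn_erase_of_lt {i l : Fin n} {I : Finset (Fin n)} (h : l < i) (hl : l ∈ I) :
    sgn i (I.erase l) = -sgn i I := by
  have hl' : l ∈ I.filter (· < i) := by simp [hl, h]
  rw [sgn, sgn, Finset.filter_erase, ← Finset.card_erase_add_one hl', pow_succ]
  simp

lemma sgn_mul_sgn_erase {i l : Fin n} {I : Finset (Fin n)} (hi : i ∈ I) (hl : l ∈ I) (h : i ≠ l) :
    sgn i I * sgn l (I.erase i) = -(sgn l I * sgn i (I.erase l)) := by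
  rcases h.lt_or_gt with h | h
  · rw [sgn_erase_of_lt h hi, sgn_erase_of_le h.le]; ring
  · rw [sgn_erase_of_lt h hl, sgn_erase_of_le h.le]; ring

lemma sgn_insert_of_lt {i l : Fin n} {I : Finset (Fin n)} (h : i < l) (hi : i ∉ I) :
    sgn l (insert i I) = -sgn l I := by
  have := sgn_erase_of_lt h (Finset.mem_insert_self i I)
  rw [Finset.erase_insert hi] at this
  rw [this, neg_neg]

end Sign

/-! ### Exactness of the two-sided Koszul complex -/

section Koszul

variable (k : Type*) [Field k] (n : ℕ) (M : Type*) [AddCommGroup M] [Module k M]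

lemma inclE_apply {p : ℕ} {I : Finset (Fin n)} (h : I.card = p) (f : Poly k n ⊗[k] M) :
    inclE k n M p I f = Finsupp.single ⟨I, h⟩ f := by
  simp [inclE, h]

lemma inclE_eq_zero {p : ℕ} {I : Finset (Fin n)} (h : I.card ≠ p) :
    inclE k n M p I = 0 := by
  simp [inclE, h]

variable {k n M} in
lemma koszul_induction {p : ℕ} {P : Koszul k n M p → Prop} (zero : P 0)
    (add : ∀ x y, P x → P y → P (x + y))
    (incl : ∀ (I : Finset (Fin n)) (f : Poly k n ⊗[k] M), I.card = p → P (inclE k n M p I f))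
    (x : Koszul k n M p) : P x := by
  induction x using Finsupp.induction_linear with
  | zero => exact zero
  | add x y hx hy => exact add x y hx hy
  | single I f => rw [← inclE_apply k n M I.2]; exact incl _ _ I.2

variable [Module (Poly k n) M] [IsScalarTower k (Poly k n) M]

lemma koszulD_inclE (p : ℕ) (I : Finset (Fin n)) (f : Poly k n ⊗[k] M) :
    koszulD k n M p (inclE k n M (p + 1) I f) =
      ∑ i ∈ I, sgn i I • inclE k n M p (I.erase i) (diffOp k n M i f) := by
  by_cases h : I.card = p + 1
  · rw [inclE_apply k n M h, koszulD, Finsupp.lsum_single, LinearMap.sum_apply]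
    rfl
  · rw [inclE_eq_zero k n M h, LinearMap.zero_apply, map_zero, eq_comm]
    refine Finset.sum_eq_zero fun i hi => ?_
    have := Finset.card_erase_add_one hi
    rw [inclE_eq_zero k n M (by omega), LinearMap.zero_apply, smul_zero]

lemma koszulD_koszulD (p : ℕ) (x : Koszul k n M (p + 2)) :
    koszulD k n M p (koszulD k n M (p + 1) x) = 0 := by
  induction x using koszul_induction with
  | zero => simp
  | add x y hx hy => simp [hx, hy]
  | incl I f hI =>
    simp only [koszulD_inclE, map_sum, map_zsmul, Finset.smul_sum, smul_smul]
    rw [Finset.sum_sigma']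
    -- Removing `i` and `l` in the two possible orders gives opposite signs.
    refine Finset.sum_involution (fun a _ => ⟨a.2, a.1⟩) ?_ ?_ ?_ ?_
    · rintro ⟨i, l⟩ h
      simp only [Finset.mem_sigma, Finset.mem_erase] at h
      rw [sgn_mul_sgn_erase h.1 h.2.2 h.2.1.symm, Finset.erase_right_comm, diffOp_comm, neg_smul,
        neg_add_cancel]
    · rintro ⟨i, l⟩ h - heq
      simp only [Finset.mem_sigma, Finset.mem_erase] at h
      exact h.2.1 (congrArg Sigma.fst heq)
    · rintro ⟨i, l⟩ h
      simp only [Finset.mem_sigma, Finset.mem_erase] at h ⊢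
      exact ⟨h.2.2, h.2.1.symm, h.1⟩
    · rintro ⟨i, l⟩ h
      rfl

/-- The indices that are smaller than all elements of `I`. -/
def below (I : Finset (Fin n)) : Finset (Fin n) := Finset.univ.filter fun i => ∀ l ∈ I, i < l

variable {n} in
lemma mem_below {I : Finset (Fin n)} {i : Fin n} : i ∈ below n I ↔ ∀ l ∈ I, i < l := by
  simp [below]

/-- The `k`-linear contracting homotopy of the two-sided Koszul complex. -/
def koszulH (p : ℕ) : Koszul k n M p →ₗ[k] Koszul k n M (p + 1) :=
  Finsupp.lsum k fun I => ∑ i ∈ below n I.1,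
    (inclE k n M (p + 1) (insert i I.1)).restrictScalars k ∘ₗ divOp k n M i

lemma koszulH_inclE (p : ℕ) (I : Finset (Fin n)) (f : Poly k n ⊗[k] M) :
    koszulH k n M p (inclE k n M p I f) =
      ∑ i ∈ below n I, inclE k n M (p + 1) (insert i I) (divOp k n M i f) := by
  by_cases h : I.card = p
  · rw [inclE_apply k n M h, koszulH, Finsupp.lsum_single, LinearMap.sum_apply]
    rfl
  · rw [inclE_eq_zero k n M h, LinearMap.zero_apply, map_zero, eq_comm]
    refine Finset.sum_eq_zero fun i hi => ?_
    have := Finset.card_insert_of_notMem fun h => (mem_below.mp hi i h).ne rfl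
    rw [inclE_eq_zero k n M (by omega), LinearMap.zero_apply]

/-- The new smallest index has sign `1` and flips the signs of all the others; this sign pattern is
why the homotopy only adds indices below `I`. -/
lemma koszulD_inclE_insert (p : ℕ) {I : Finset (Fin n)} {i : Fin n} (h : ∀ l ∈ I, i < l)
    (f : Poly k n ⊗[k] M) :
    koszulD k n M p (inclE k n M (p + 1) (insert i I) f) =
      inclE k n M p I (diffOp k n M i f) -
        ∑ l ∈ I, sgn l I • inclE k n M p (insert i (I.erase l)) (diffOp k n M l f) := by
  have hi : i ∉ I := fun hi => (h i hi).ne rfl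
  rw [koszulD_inclE, Finset.sum_insert hi, Finset.erase_insert hi, sgn_insert_self,
    sgn_of_forall_lt h, one_smul, sub_eq_add_neg, ← Finset.sum_neg_distrib]
  congr 1
  refine Finset.sum_congr rfl fun l hl => ?_
  rw [sgn_insert_of_lt (h l hl) hi, neg_smul, Finset.erase_insert_of_ne (h l hl).ne]

/-- The sum is the homotopy applied to one term of the differential, with `J = I ∖ l`. The operators
commute for `i < l`, the term vanishes for `i > l`, and `i = l` contributes `moveOp`. -/
lemma sum_below_insert {p : ℕ} {J : Finset (Fin n)} (l : Fin n)
    (f : Poly k n ⊗[k] M) :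
    ∑ i ∈ below n J, inclE k n M p (insert i J) (divOp k n M i (diffOp k n M l f)) =
      (∑ i ∈ below n (insert l J),
        inclE k n M p (insert i J) (diffOp k n M l (divOp k n M i f))) +
      if l ∈ below n J then inclE k n M p (insert l J) (moveOp k n M l f) else 0 := by
  have hsub : below n (insert l J) ⊆ below n J := fun i hi =>
    mem_below.mpr fun j hj => mem_below.mp hi j (Finset.mem_insert_of_mem hj)
  have hfirst : ∀ i ∈ below n (insert l J), i < l := fun i hi =>
    mem_below.mp hi l (Finset.mem_insert_self _ _)
  have hrest : ∀ i ∈ below n J \ below n (insert l J), l ≤ i := by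
    intro i hi
    by_contra hlt
    rw [Finset.mem_sdiff, mem_below, mem_below, Finset.forall_mem_insert] at hi
    exact hi.2 ⟨not_le.mp hlt, hi.1⟩
  rw [← Finset.sum_sdiff hsub, add_comm]
  congr 1
  · exact Finset.sum_congr rfl fun i hi => by rw [divOp_diffOp_of_gt k n M (hfirst i hi)]
  · split_ifs with h
    · rw [Finset.sum_eq_single_of_mem l, divOp_diffOp_self]
      · refine Finset.mem_sdiff.mpr ⟨h, fun h' => (hfirst l h').ne rfl⟩
      · intro i hi hne
        rw [divOp_diffOp_of_lt k n M (lt_of_le_of_ne (hrest i hi) hne.symm), map_zero]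
    · refine Finset.sum_eq_zero fun i hi => ?_
      have hne : l ≠ i := by
        rintro rfl
        exact h (Finset.mem_sdiff.mp hi).1
      rw [divOp_diffOp_of_lt k n M (lt_of_le_of_ne (hrest i hi) hne), map_zero]

lemma sum_Iio_moveOp_sub (m : ℕ) (hm : m ≤ n) (f : Poly k n ⊗[k] M) :
    ∑ i ∈ Finset.univ.filter (fun i : Fin n => (i : ℕ) < m), (moveOp k n M i f - moveOp k n M (i + 1) f) =
      f - moveOp k n M m f := by
  rw [Finset.sum_filter, Fin.sum_univ_eq_sum_range
    (fun i => if i < m then moveOp k n M i f - moveOp k n M (i + 1) f else 0),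
    ← Finset.sum_filter]
  have : (Finset.range n).filter (· < m) = Finset.range m := by
    ext; simp; omega
  rw [this, Finset.sum_range_sub', moveOp_zero]

lemma sum_below_inclE (p : ℕ) (I : Finset (Fin n)) (m : ℕ) (hm : m ≤ n)
    (h : below n I = Finset.univ.filter fun i : Fin n => (i : ℕ) < m) (f : Poly k n ⊗[k] M) :
    ∑ i ∈ below n I, inclE k n M p I (diffOp k n M i (divOp k n M i f)) =
      inclE k n M p I f - inclE k n M p I (moveOp k n M m f) := by
  simp only [diffOp_divOp, h]
  rw [← map_sum, sum_Iio_moveOp_sub k n M m hm, map_sub]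

/-- Here `m` is `n` for empty `I` and `min I` otherwise. The double sum is what the homotopy after
the differential has to cancel. -/
lemma koszulD_koszulH_inclE (p : ℕ) (I : Finset (Fin n)) (m : ℕ) (hm : m ≤ n)
    (h : below n I = Finset.univ.filter fun i : Fin n => (i : ℕ) < m) (f : Poly k n ⊗[k] M) :
    koszulD k n M p (koszulH k n M p (inclE k n M p I f)) =
      inclE k n M p I f - inclE k n M p I (moveOp k n M m f) -
        ∑ l ∈ I, ∑ i ∈ below n I, sgn l I • inclE k n M p (insert i (I.erase l))
          (diffOp k n M l (divOp k n M i f)) := by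
  rw [koszulH_inclE, map_sum, Finset.sum_congr rfl fun i hi =>
    koszulD_inclE_insert k n M p (mem_below.mp hi) _, Finset.sum_sub_distrib,
    sum_below_inclE k n M p I m hm h, Finset.sum_comm]

lemma koszulD_koszulH_zero (x : Koszul k n M 0) (hx : koszulAug k n M x = 0) :
    koszulD k n M 0 (koszulH k n M 0 x) = x := by
  -- Every index lies below `∅`, so the telescope runs to its end.
  have key (x : Koszul k n M 0) : koszulD k n M 0 (koszulH k n M 0 x) =
      x - inclE k n M 0 ∅ (1 ⊗ₜ koszulAug k n M x) := by
    induction x using koszul_induction with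
    | zero => simp
    | add x y hx hy => simp only [map_add, TensorProduct.tmul_add, hx, hy]; abel
    | incl I f hI =>
      obtain rfl := Finset.card_eq_zero.mp hI
      rw [koszulD_koszulH_inclE k n M 0 ∅ n le_rfl (by ext; simp [mem_below]),
        Finset.sum_empty, sub_zero, inclE_apply k n M hI f, koszulAug, Finsupp.lsum_single]
      congr 2
      induction f using TensorProduct.induction_on with
      | zero => simp
      | tmul s m => simp [moveOp_tmul_top]
      | add x y hx hy => simp only [map_add, TensorProduct.tmul_add, hx, hy]
  rw [key, hx, TensorProduct.tmul_zero, map_zero, sub_zero]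

lemma koszulD_koszulH_add (p : ℕ) (x : Koszul k n M (p + 1)) :
    koszulD k n M (p + 1) (koszulH k n M (p + 1) x) + koszulH k n M p (koszulD k n M p x) = x := by
  induction x using koszul_induction with
  | zero => simp
  | add x y hx hy =>
    simp only [map_add]
    rw [add_add_add_comm, hx, hy]
  | incl I f hI =>
    have hne : I.Nonempty := Finset.card_pos.mp (by omega)
    set m := I.min' hne with hm
    have hmI : m ∈ I := I.min'_mem hne
    have hbelow : below n I = Finset.univ.filter fun i : Fin n => (i : ℕ) < (m : ℕ) := by
      ext i
      simp only [mem_below, Finset.mem_filter, Finset.mem_univ, true_and, Fin.val_fin_lt]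
      exact ⟨fun h => h m hmI, fun h l hl => h.trans_le (I.min'_le l hl)⟩
    rw [koszulD_koszulH_inclE k n M (p + 1) I m m.2.le hbelow, koszulD_inclE, map_sum]
    -- Only `l = min I` lies below the rest of `I`. Its `moveOp` term cancels the one left over by
    -- the telescope.
    have hterm : ∀ l ∈ I, koszulH k n M p
        (sgn l I • inclE k n M p (I.erase l) (diffOp k n M l f)) =
        (∑ i ∈ below n I, sgn l I • inclE k n M (p + 1) (insert i (I.erase l))
          (diffOp k n M l (divOp k n M i f))) +
        if l = m then inclE k n M (p + 1) I (moveOp k n M m f) else 0 := by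
      intro l hl
      rw [map_zsmul, koszulH_inclE, sum_below_insert,
        Finset.insert_erase hl, smul_add, Finset.smul_sum]
      congr 1
      have hiff : l ∈ below n (I.erase l) ↔ l = m := by
        rw [mem_below]
        constructor
        · intro h
          by_contra hlm
          exact (h m (Finset.mem_erase.mpr ⟨fun h => hlm h.symm, hmI⟩)).not_ge (I.min'_le l hl)
        · rintro rfl i hi
          exact lt_of_le_of_ne (I.min'_le i (Finset.mem_of_mem_erase hi))
            (Finset.ne_of_mem_erase hi).symm
      by_cases h : l = m
      · rw [if_pos (hiff.mpr h), if_pos h, h, sgn, Finset.filter_eq_empty_iff.mpr]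
        · simp
        · exact fun i hi => not_lt.mpr (I.min'_le i hi)
      · rw [if_neg (fun h' => h (hiff.mp h')), if_neg h, smul_zero]
    rw [Finset.sum_congr rfl hterm, Finset.sum_add_distrib, Finset.sum_ite_eq' I m, if_pos hmI]
    abel

lemma koszulAug_inclE (I : Finset (Fin n)) (hI : I.card = 0) (s : Poly k n) (m : M) :
    koszulAug k n M (inclE k n M 0 I (s ⊗ₜ m)) = s • m := by
  rw [inclE_apply k n M hI, koszulAug, Finsupp.lsum_single]
  simp

lemma koszulAug_koszulD (x : Koszul k n M 1) : koszulAug k n M (koszulD k n M 0 x) = 0 := by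
  induction x using koszul_induction with
  | zero => simp
  | add x y hx hy => simp [hx, hy]
  | incl I f hI =>
    obtain ⟨i, rfl⟩ := Finset.card_eq_one.mp hI
    rw [koszulD_inclE, Finset.sum_singleton, map_zsmul]
    have h0 : (({i} : Finset (Fin n)).erase i).card = 0 := by simp
    induction f using TensorProduct.induction_on with
    | zero => simp
    | tmul s m =>
      rw [diffOp_tmul, map_sub, map_sub, koszulAug_inclE k n M _ h0, koszulAug_inclE k n M _ h0,
        smul_smul, mul_comm, sub_self, smul_zero]
    | add x y hx hy => simp only [map_add, smul_add, hx, hy, add_zero]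

/-- The two-sided Koszul complex is a free resolution of `M`. -/
theorem koszul_isFreeResolution :
    IsFreeResolution (R := Poly k n) (K := Koszul k n M) (koszulD k n M) (koszulAug k n M) where
  free p := Module.Free.of_basis (koszulBasis (Module.Basis.ofVectorSpace k M) p)
  surjective m := ⟨inclE k n M 0 ∅ (1 ⊗ₜ m), by rw [koszulAug_inclE k n M ∅ rfl, one_smul]⟩
  exact_zero x := by
    constructor
    · exact fun hx => ⟨_, koszulD_koszulH_zero k n M x hx⟩
    · rintro ⟨y, rfl⟩
      exact koszulAug_koszulD k n M y
  exact_succ p x := by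
    constructor
    · intro hx
      have := koszulD_koszulH_add k n M p x
      rw [hx, map_zero, add_zero] at this
      exact ⟨_, this⟩
    · rintro ⟨y, rfl⟩
      exact koszulD_koszulD k n M p y

end Koszul

/-! ### Terms and initial modules -/

section Terms

variable {k : Type*} [Field k] {n : ℕ} {ι : Type*}

/-- The coefficient of a term, as a linear form on the free module. -/
def termCoeff (t : Term n ι) : (ι →₀ Poly k n) →ₗ[k] k :=
  MvPolynomial.lcoeff k t.1 ∘ₗ (Finsupp.lapply t.2 : (ι →₀ Poly k n) →ₗ[k] Poly k n)

lemma termCoeff_apply (t : Term n ι) (f : ι →₀ Poly k n) :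
    termCoeff t f = (f t.2).coeff t.1 := rfl

lemma isInitialTerm_iff {ord : TermOrder n ι} {f : ι →₀ Poly k n} {t : Term n ι} :
    IsInitialTerm ord f t ↔
      termCoeff t f ≠ 0 ∧ ∀ s, termCoeff s f ≠ 0 → s ≠ t → ord.lt s t := Iff.rfl

open Classical in
lemma termCoeff_termVec (s t : Term n ι) :
    termCoeff s (termVec k t) = if t = s then 1 else 0 := by
  obtain ⟨α, j⟩ := t
  obtain ⟨β, l⟩ := s
  by_cases hj : j = l
  · subst hj
    simp [termCoeff_apply, termVec, MvPolynomial.coeff_monomial]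
  · simp [termCoeff_apply, termVec, hj]

lemma termCoeff_ext {f g : ι →₀ Poly k n} (h : ∀ t, termCoeff t f = termCoeff t g) : f = g := by
  ext j α
  exact h (α, j)

lemma mem_span_termVec (f : ι →₀ Poly k n) :
    f ∈ Submodule.span k (termVec k '' {t | termCoeff t f ≠ 0}) := by
  suffices f.sum Finsupp.single ∈ Submodule.span k (termVec k '' {t | termCoeff t f ≠ 0}) by
    rwa [Finsupp.sum_single] at this
  refine Submodule.sum_mem _ fun j _ => ?_
  rw [← MvPolynomial.support_sum_monomial_coeff (f j),
    ← Finsupp.singleAddHom_apply, map_sum]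
  refine Submodule.sum_mem _ fun α hα => ?_
  have : Finsupp.singleAddHom j (MvPolynomial.monomial α ((f j).coeff α)) =
      (f j).coeff α • termVec k (α, j) := by
    simp [termVec, MvPolynomial.smul_monomial]
  rw [this]
  refine Submodule.smul_mem _ _ (Submodule.subset_span ⟨(α, j), ?_, rfl⟩)
  exact MvPolynomial.mem_support_iff.mp hα

lemma finite_setOf_termCoeff_ne_zero (f : ι →₀ Poly k n) :
    {t : Term n ι | termCoeff t f ≠ 0}.Finite := by
  classical
  refine (f.support.biUnion fun j => (f j).support.image fun α => (α, j)).finite_toSet.subset ?_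
  rintro ⟨α, j⟩ h
  have h' : (f j).coeff α ≠ 0 := h
  simp only [Finset.coe_biUnion, Set.mem_iUnion, Finset.mem_coe, Finset.mem_image]
  refine ⟨j, ?_, α, MvPolynomial.mem_support_iff.mpr h', rfl⟩
  rw [Finsupp.mem_support_iff]
  rintro h0
  simp [h0] at h'

lemma exists_isInitialTerm (ord : TermOrder n ι) {f : ι →₀ Poly k n} (hf : f ≠ 0) :
    ∃ t, IsInitialTerm ord f t := by
  classical
  have := ord.isStrictTotalOrder
  let := linearOrderOfSTO ord.lt
  have hne : {t : Term n ι | termCoeff t f ≠ 0}.Nonempty := by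
    by_contra h
    rw [Set.not_nonempty_iff_eq_empty, Set.eq_empty_iff_forall_notMem] at h
    exact hf (termCoeff_ext fun t => by simpa using h t)
  obtain ⟨t, ht, hmax⟩ := Set.exists_max_image _ id (finite_setOf_termCoeff_ne_zero f) hne
  exact ⟨t, ht, fun s hs hst => lt_of_le_of_ne (hmax s hs) hst⟩

lemma monomial_smul_termVec (γ : Fin n →₀ ℕ) (t : Term n ι) :
    (MvPolynomial.monomial γ 1 : Poly k n) • termVec k t = termVec k (γ + t.1, t.2) := by
  simp [termVec, MvPolynomial.monomial_mul]

lemma termCoeff_monomial_smul (γ : Fin n →₀ ℕ) (f : ι →₀ Poly k n) (t : Term n ι) :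
    termCoeff (γ + t.1, t.2) ((MvPolynomial.monomial γ 1 : Poly k n) • f) = termCoeff t f := by
  simp [termCoeff_apply, MvPolynomial.coeff_monomial_mul]

lemma exists_of_termCoeff_smul_ne_zero {p : Poly k n} {f : ι →₀ Poly k n} {t : Term n ι}
    (h : termCoeff t (p • f) ≠ 0) :
    ∃ γ β, γ + β = t.1 ∧ p.coeff γ ≠ 0 ∧ termCoeff (β, t.2) f ≠ 0 := by
  rw [termCoeff_apply, Finsupp.smul_apply, smul_eq_mul, MvPolynomial.coeff_mul] at h
  obtain ⟨⟨γ, β⟩, hmem, hne⟩ := Finset.exists_ne_zero_of_sum_ne_zero h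
  exact ⟨γ, β, Finset.HasAntidiagonal.mem_antidiagonal.mp hmem, left_ne_zero_of_mul hne,
    right_ne_zero_of_mul hne⟩

lemma isInitialTerm_monomial_smul {ord : TermOrder n ι} {f : ι →₀ Poly k n} {t : Term n ι}
    (h : IsInitialTerm ord f t) (γ : Fin n →₀ ℕ) :
    IsInitialTerm ord ((MvPolynomial.monomial γ 1 : Poly k n) • f) (γ + t.1, t.2) := by
  rw [isInitialTerm_iff] at h ⊢
  refine ⟨by rw [termCoeff_monomial_smul]; exact h.1, fun s hs hne => ?_⟩
  obtain ⟨γ', β, hsum, hγ, hβ⟩ := exists_of_termCoeff_smul_ne_zero hs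
  rw [MvPolynomial.coeff_monomial] at hγ
  obtain rfl : γ = γ' := by by_contra hne; simp [hne] at hγ
  have hs' : s = (γ + β, s.2) := Prod.ext hsum.symm rfl
  have hlt := ord.mul_lt_mul γ _ _ (h.2 _ hβ fun h => hne (by rw [hs', ← h]))
  rwa [← hs'] at hlt

/-- Divisibility of every occurring term by some term of `B` is stable under sums and multiples. -/
lemma exists_le_of_termVec_mem_span {B : Set (Term n ι)} {t : Term n ι}
    (h : termVec k t ∈ Submodule.span (Poly k n) (termVec k '' B)) :
    ∃ s ∈ B, s.2 = t.2 ∧ s.1 ≤ t.1 := by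
  classical
  have key : ∀ f ∈ Submodule.span (Poly k n) (termVec k '' B), ∀ t : Term n ι,
      termCoeff t f ≠ 0 → ∃ s ∈ B, s.2 = t.2 ∧ s.1 ≤ t.1 := by
    intro f hf
    induction hf using Submodule.span_induction with
    | mem x hx =>
      obtain ⟨s, hs, rfl⟩ := hx
      intro t ht
      rw [termCoeff_termVec] at ht
      obtain rfl : s = t := by by_contra hne; simp [hne] at ht
      exact ⟨s, hs, rfl, le_rfl⟩
    | zero => simp
    | add x y _ _ hx hy =>
      intro t ht
      by_cases hxt : termCoeff t x = 0
      · exact hy t (by rwa [map_add, hxt, zero_add] at ht)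
      · exact hx t hxt
    | smul p x _ hx =>
      intro t ht
      obtain ⟨γ, β, hsum, -, hβ⟩ := exists_of_termCoeff_smul_ne_zero ht
      obtain ⟨s, hs, hs2, hs1⟩ := hx _ hβ
      exact ⟨s, hs, hs2, hs1.trans (hsum ▸ le_add_self)⟩
  exact key _ h t (by simp [termCoeff_termVec])

/-- Term orders on free modules of finite rank are well-founded, by Dickson's lemma. -/
theorem TermOrder.wellFounded [Finite ι] (ord : TermOrder n ι) : WellFounded ord.lt := by
  have := ord.isStrictTotalOrder
  rw [wellFounded_iff_isEmpty_descending_chain]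
  refine ⟨fun ⟨f, hf⟩ => ?_⟩
  have hwqo : WellQuasiOrdered fun s t : Term n ι => s.1 ≤ t.1 ∧ s.2 = t.2 :=
    WellQuasiOrdered.prod wellQuasiOrdered_le (Finite.wellQuasiOrdered _)
  -- In a descending chain an earlier term would divide a later, smaller one, against `lt_mul`.
  obtain ⟨a, c, hac, h1, h2⟩ := hwqo f
  have hdesc : ord.lt (f c) (f a) := by
    clear h1 h2
    induction c, hac using Nat.le_induction with
    | base => exact hf a
    | succ c _ ih => exact _root_.trans (hf c) ih
  obtain ⟨γ, hγ⟩ := exists_add_of_le h1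
  have heq : f c = (γ + (f a).1, (f a).2) := Prod.ext (by rw [hγ, add_comm]) h2.symm
  by_cases h0 : γ = 0
  · rw [heq, h0, zero_add] at hdesc
    exact irrefl _ hdesc
  · have := ord.lt_mul γ (f a) h0
    rw [← heq] at this
    exact asymm this hdesc

lemma constantCoeff_eq_zero_of_mem_irrelevant {p : Poly k n} (hp : p ∈ irrelevant k n) :
    p.coeff 0 = 0 := by
  have h : irrelevant k n ≤ RingHom.ker (MvPolynomial.constantCoeff (σ := Fin n) (R := k)) := by
    rw [irrelevant, Ideal.span_le]
    rintro _ ⟨i, rfl⟩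
    simp
  exact h hp

lemma apply_mem_of_mem_smul_top {R B : Type*} [CommRing R] {I : Ideal R} {f : B →₀ R}
    (hf : f ∈ I • (⊤ : Submodule R (B →₀ R))) (c : B) : f c ∈ I := by
  induction hf using Submodule.smul_induction_on' with
  | smul r hr x _ => exact I.mul_mem_right _ hr
  | add x _ y _ hx hy => exact I.add_mem hx hy

lemma mem_smul_top_of_apply_mem {R B : Type*} [CommRing R] {I : Ideal R} {f : B →₀ R}
    (hf : ∀ c, f c ∈ I) : f ∈ I • (⊤ : Submodule R (B →₀ R)) := by
  rw [← Finsupp.sum_single f]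
  refine Submodule.sum_mem _ fun c _ => ?_
  have : Finsupp.single c (f c) = f c • Finsupp.single c (1 : R) := by simp
  rw [this]
  exact Submodule.smul_mem_smul (hf c) trivial

end Terms

/-! ### The basis of standard terms -/

section StandardBasis

variable {k : Type*} [Field k] {n : ℕ} {ι : Type*}
  {M : Type*} [AddCommGroup M] [Module k M] [Module (Poly k n) M]
  [IsScalarTower k (Poly k n) M]
  {ord : TermOrder n ι} {η : (ι →₀ Poly k n) →ₗ[Poly k n] M}

lemma initialModule_eq_span (ord : TermOrder n ι)
    (K : Submodule (Poly k n) (ι →₀ Poly k n)) :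
    initialModule ord K =
      Submodule.span (Poly k n) (termVec k '' {t | ∃ f ∈ K, IsInitialTerm ord f t}) := by
  rw [initialModule]
  congr 1
  ext v
  constructor
  · rintro ⟨f, hf, t, ht, rfl⟩
    exact ⟨t, ⟨f, hf, ht⟩, rfl⟩
  · rintro ⟨t, ⟨f, hf, ht⟩, rfl⟩
    exact ⟨f, hf, t, ht, rfl⟩

lemma InitiallyLinear.exists_mem_crit (hlin : InitiallyLinear ord η) {f : ι →₀ Poly k n}
    (hf : η f = 0) {t : Term n ι} (ht : IsInitialTerm ord f t) :
    ∃ i ∈ t.1.support, i ∈ crit ord η t.2 := by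
  obtain ⟨A, hA⟩ := hlin.linear
  have hmem : termVec k t ∈ initialModule ord (LinearMap.ker η) :=
    Submodule.subset_span ⟨f, hf, t, ht, rfl⟩
  rw [hA, ← Set.image_image (termVec k) fun a : Fin n × ι => (Finsupp.single a.1 1, a.2)] at hmem
  obtain ⟨_, ⟨⟨i, j⟩, ha, rfl⟩, hj, hle⟩ := exists_le_of_termVec_mem_span hmem
  refine ⟨i, ?_, ?_⟩
  · have := hle i
    simp only [Finsupp.single_eq_same] at this
    rw [Finsupp.mem_support_iff]
    omega
  · rw [← hj]
    change termVec k (Finsupp.single i 1, j) ∈ initialModule ord (LinearMap.ker η)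
    rw [hA]
    exact Submodule.subset_span ⟨(i, j), ha, rfl⟩

/-- Membership in the initial module becomes an actual syzygy to reduce with: some syzygy has an
initial term dividing `x_i g_j`, and a monomial multiple of it has initial term `t`. -/
lemma exists_isInitialTerm_of_mem_crit {t : Term n ι} {i : Fin n} (hi : i ∈ t.1.support)
    (hc : i ∈ crit ord η t.2) : ∃ f, η f = 0 ∧ IsInitialTerm ord f t := by
  have hc' : termVec k (Finsupp.single i 1, t.2) ∈ initialModule ord (LinearMap.ker η) := hc
  rw [initialModule_eq_span] at hc'
  obtain ⟨s, ⟨f, hf, hs⟩, hj, hle⟩ := exists_le_of_termVec_mem_span hc'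
  have hle' : s.1 ≤ t.1 := hle.trans (by
    rw [Finsupp.single_le_iff]
    have := Finsupp.mem_support_iff.mp hi
    omega)
  obtain ⟨γ, hγ⟩ := exists_add_of_le hle'
  have ht : t = (γ + s.1, s.2) := Prod.ext (by rw [hγ, add_comm]) hj.symm
  refine ⟨(MvPolynomial.monomial γ 1 : Poly k n) • f, ?_, ?_⟩
  · rw [map_smul, LinearMap.mem_ker.mp hf, smul_zero]
  · rw [ht]
    exact isInitialTerm_monomial_smul hs γ

/-- Normal form reduction. The second half, with strictly smaller terms for a nonstandard `t`, is
what later makes the matching acyclic. -/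
lemma apply_termVec_mem_span_aux [Finite ι] (t : Term n ι) :
    η (termVec k t) ∈ Submodule.span k
      ((fun s : StdTerm ord η => η (termVec k s.1)) '' {s | s.1 = t ∨ ord.lt s.1 t}) ∧
    ((∃ i ∈ t.1.support, i ∈ crit ord η t.2) → η (termVec k t) ∈ Submodule.span k
      ((fun s : StdTerm ord η => η (termVec k s.1)) '' {s | ord.lt s.1 t})) := by
  have := ord.isStrictTotalOrder
  induction t using ord.wellFounded.induction with
  | _ t ih =>
  have hnonstd : (∃ i ∈ t.1.support, i ∈ crit ord η t.2) → η (termVec k t) ∈ Submodule.span k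
      ((fun s : StdTerm ord η => η (termVec k s.1)) '' {s | ord.lt s.1 t}) := by
    rintro ⟨i, hi, hc⟩
    obtain ⟨f, hf, hlead, hlt⟩ := exists_isInitialTerm_of_mem_crit hi hc
    change termCoeff t f ≠ 0 at hlead
    -- Subtracting the normalised syzygy cancels `t` and leaves smaller terms only.
    set g := termVec k t - (termCoeff t f)⁻¹ • f with hg
    have hη : η (termVec k t) = η g := by
      have : η ((termCoeff t f)⁻¹ • f) = 0 := by
        rw [← algebraMap_smul (Poly k n), map_smul, hf, smul_zero]
      rw [hg, map_sub, this, sub_zero]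
    have hgt : ∀ s, termCoeff s g ≠ 0 → ord.lt s t := by
      classical
      intro s hs
      rw [hg, map_sub, map_smul, termCoeff_termVec, smul_eq_mul] at hs
      by_cases hst : t = s
      · subst hst
        simp [hlead] at hs
      · rw [if_neg hst, zero_sub, neg_ne_zero] at hs
        exact hlt s (right_ne_zero_of_mul hs) (Ne.symm hst)
    rw [hη]
    have hmem := Submodule.mem_map_of_mem (f := η.restrictScalars k) (mem_span_termVec g)
    rw [Submodule.map_span] at hmem
    refine (Submodule.span_le.mpr ?_) hmem
    rintro _ ⟨_, ⟨s, hs, rfl⟩, rfl⟩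
    refine Submodule.span_mono (Set.image_mono ?_) (ih s (hgt s hs)).1
    rintro s' (h | h)
    · exact (congrArg (ord.lt · t) h).mpr (hgt s hs)
    · exact _root_.trans h (hgt s hs)
  refine ⟨?_, hnonstd⟩
  by_cases h : ∃ i ∈ t.1.support, i ∈ crit ord η t.2
  · exact Submodule.span_mono (Set.image_mono fun s hs => Or.inr hs) (hnonstd h)
  · push Not at h
    exact Submodule.subset_span ⟨⟨t, h⟩, Or.inl rfl, rfl⟩

/-- A relation lifts to a syzygy supported on standard terms. If it were nonzero, its initial term
would be divisible by a critical variable. -/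
lemma InitiallyLinear.linearIndependent (hlin : InitiallyLinear ord η) :
    LinearIndependent k fun s : StdTerm ord η => η (termVec k s.1) := by
  classical
  rw [linearIndependent_iff]
  intro l hl
  set f : ι →₀ Poly k n := Finsupp.linearCombination k (fun s : StdTerm ord η => termVec k s.1) l
    with hf
  have hηf : η f = 0 := by
    rw [← hl, hf, ← LinearMap.restrictScalars_apply k η, Finsupp.apply_linearCombination]
    rfl
  have hcoeff (t : Term n ι) : termCoeff t f = l.sum fun s c => if s.1 = t then c else 0 := by
    rw [hf, Finsupp.linearCombination_apply, map_finsuppSum]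
    simp [termCoeff_termVec]
  have hf0 : f = 0 := by
    by_contra hne
    obtain ⟨t, ht⟩ := exists_isInitialTerm ord hne
    obtain ⟨i, hi, hc⟩ := hlin.exists_mem_crit hηf ht
    refine ht.1 ((hcoeff t).trans (Finset.sum_eq_zero fun s _ => if_neg ?_))
    rintro rfl
    exact s.2 i hi hc
  ext s
  have h := hcoeff s.1
  rw [hf0, map_zero, Finsupp.sum, Finset.sum_eq_single s] at h
  · simpa using h.symm
  · intro s' _ hne
    exact if_neg fun h => hne (Subtype.ext h)
  · intro hs
    simpa using hs

lemma top_le_span_stdTerm [Finite ι] (ord : TermOrder n ι) (hη : Function.Surjective η) :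
    ⊤ ≤ Submodule.span k (Set.range fun s : StdTerm ord η => η (termVec k s.1)) := by
  rintro m -
  obtain ⟨f, rfl⟩ := hη m
  have hmem := Submodule.mem_map_of_mem (f := η.restrictScalars k) (mem_span_termVec f)
  rw [Submodule.map_span] at hmem
  refine (Submodule.span_le.mpr ?_) hmem
  rintro _ ⟨_, ⟨s, -, rfl⟩, rfl⟩
  exact Submodule.span_mono (Set.image_subset_range _ _) (apply_termVec_mem_span_aux s).1

/-- The standard terms form a `k`-basis of `M`. -/
theorem InitiallyLinear.exists_basis [Finite ι] (hlin : InitiallyLinear ord η)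
    (hη : Function.Surjective η) :
    ∃ b : Module.Basis (StdTerm ord η) k M, ∀ t, b t = η (termVec k t.1) :=
  ⟨Module.Basis.mk hlin.linearIndependent (top_le_span_stdTerm ord hη),
    fun t => Module.Basis.mk_apply _ _ t⟩

variable {b : Module.Basis (StdTerm ord η) k M}

lemma X_smul_apply_termVec (i : Fin n) (t : Term n ι) :
    (MvPolynomial.X i : Poly k n) • η (termVec k t) =
      η (termVec k (t.1 + Finsupp.single i 1, t.2)) := by
  rw [← map_smul, MvPolynomial.X, monomial_smul_termVec, add_comm]

lemma repr_mem_span_image {s : Set (StdTerm ord η)} (hb : ∀ t, b t = η (termVec k t.1)) {m : M}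
    (h : m ∈ Submodule.span k ((fun s : StdTerm ord η => η (termVec k s.1)) '' s))
    {t : StdTerm ord η} (ht : b.repr m t ≠ 0) : t ∈ s := by
  have hb' : (fun s : StdTerm ord η => η (termVec k s.1)) = b := funext fun t => (hb t).symm
  rw [hb', b.mem_span_image] at h
  exact h (by simpa using ht)

lemma repr_lt_of_mem_crit [Finite ι] (hb : ∀ t, b t = η (termVec k t.1)) {t : Term n ι}
    {i : Fin n} (hi : i ∈ t.1.support) (hc : i ∈ crit ord η t.2) {s : StdTerm ord η}
    (hs : b.repr (η (termVec k t)) s ≠ 0) : ord.lt s.1 t :=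
  repr_mem_span_image hb ((apply_termVec_mem_span_aux t).2 ⟨i, hi, hc⟩) hs

/-- The source of minimality. The lifted normal form minus `t` is a syzygy, so its coefficients have
no constant part, and `t` has none either. -/
lemma repr_ne_zero_term (hlin : InitiallyLinear ord η) (hb : ∀ t, b t = η (termVec k t.1))
    {t : Term n ι} (ht : t.1 ≠ 0) {s : StdTerm ord η}
    (hs : b.repr (η (termVec k t)) s ≠ 0) : s.1.1 ≠ 0 := by
  classical
  intro h0
  set f : ι →₀ Poly k n := Finsupp.linearCombination k (fun s : StdTerm ord η => termVec k s.1)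
    (b.repr (η (termVec k t))) with hf
  have hηf : η f = η (termVec k t) := by
    rw [hf, ← LinearMap.restrictScalars_apply k η, Finsupp.apply_linearCombination]
    conv_rhs => rw [← b.linearCombination_repr (η (termVec k t))]
    congr 2
    exact funext fun t => (hb t).symm
  have hker : f - termVec k t ∈ LinearMap.ker η := by
    rw [LinearMap.mem_ker, map_sub, hηf, sub_self]
  have hcoeff := constantCoeff_eq_zero_of_mem_irrelevant
    (apply_mem_of_mem_smul_top (hlin.ker_le hker) s.1.2)
  rw [← h0] at hcoeff
  change termCoeff s.1 (f - termVec k t) = 0 at hcoeff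
  rw [map_sub, termCoeff_termVec, if_neg fun h => ht (by rw [h, h0]), sub_zero, hf,
    Finsupp.linearCombination_apply, map_finsuppSum, Finsupp.sum, Finset.sum_eq_single s] at hcoeff
  · simp [termCoeff_termVec] at hcoeff
    exact hs hcoeff
  · intro s' _ hne
    rw [map_smul, termCoeff_termVec, if_neg fun h => hne (Subtype.ext h), smul_zero]
  · intro h
    rw [Finsupp.notMem_support_iff.mp h, zero_smul, map_zero]

/-! ### Homogeneity -/

variable {ℳ : ℤ → Submodule k M} {deg : ι → ℤ}

lemma IsGrading.monomial_smul_mem (hℳ : IsGrading (n := n) ℳ) (α : Fin n →₀ ℕ) {d : ℤ} {m : M}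
    (hm : m ∈ ℳ d) : (MvPolynomial.monomial α 1 : Poly k n) • m ∈ ℳ (α.degree + d) := by
  induction α using Finsupp.induction_linear generalizing d m with
  | zero =>
    have : (MvPolynomial.monomial 0 1 : Poly k n) = 1 := rfl
    simpa [this] using hm
  | add f g hf hg =>
    have : (MvPolynomial.monomial (f + g) 1 : Poly k n) =
        MvPolynomial.monomial f 1 * MvPolynomial.monomial g 1 := by
      simp [MvPolynomial.monomial_mul]
    rw [this, mul_smul, map_add, Nat.cast_add, add_assoc]
    exact hf (hg hm)
  | single i a =>
    induction a generalizing d m with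
    | zero =>
      have : (MvPolynomial.monomial (Finsupp.single i 0) 1 : Poly k n) = 1 := by simp
      simpa [this] using hm
    | succ a ih =>
      have : (MvPolynomial.monomial (Finsupp.single i (a + 1)) 1 : Poly k n) =
          MvPolynomial.X i * MvPolynomial.monomial (Finsupp.single i a) 1 := by
        rw [MvPolynomial.X, MvPolynomial.monomial_mul, ← Finsupp.single_add, add_comm, one_mul]
      rw [this, mul_smul]
      have := hℳ.X_smul_mem _ i _ (ih hm)
      rw [Finsupp.degree_single] at this ⊢
      convert this using 2
      push_cast
      ring

lemma apply_termVec_mem (hℳ : IsGrading (n := n) ℳ)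
    (hdeg : ∀ j, η (Finsupp.single j 1) ∈ ℳ (deg j)) (t : Term n ι) :
    η (termVec k t) ∈ ℳ (t.1.degree + deg t.2) := by
  have : termVec k t = (MvPolynomial.monomial t.1 1 : Poly k n) • Finsupp.single t.2 1 := by
    simp [termVec]
  rw [this, map_smul]
  exact hℳ.monomial_smul_mem _ (hdeg _)

/-- The basis is homogeneous, so the projection `P` onto degree `d` is diagonal in it, while it
fixes `m`. -/
lemma repr_degree (hℳ : IsGrading (n := n) ℳ) (hb : ∀ t, b t = η (termVec k t.1))
    (hdeg : ∀ j, η (Finsupp.single j 1) ∈ ℳ (deg j)) {d : ℤ} {m : M} (hm : m ∈ ℳ d)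
    {s : StdTerm ord η} (hs : b.repr m s ≠ 0) : (s.1.1.degree : ℤ) + deg s.1.2 = d := by
  classical
  let := hℳ.isInternal.chooseDecomposition
  let P : M →ₗ[k] M := (ℳ d).subtype ∘ₗ DirectSum.component k ℤ (fun i => ℳ i) d ∘ₗ
    (DirectSum.decomposeLinearEquiv ℳ).toLinearMap
  have hP (x : M) : P x = DirectSum.decompose ℳ x d := rfl
  have hPb (t : StdTerm ord η) :
      P (b t) = if (t.1.1.degree : ℤ) + deg t.1.2 = d then b t else 0 := by
    have hmem : b t ∈ ℳ (t.1.1.degree + deg t.1.2) := by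
      rw [hb]; exact apply_termVec_mem hℳ hdeg t.1
    split_ifs with h
    · rw [hP, ← h, DirectSum.decompose_of_mem_same ℳ hmem]
    · rw [hP, DirectSum.decompose_of_mem_ne ℳ hmem h]
  have hrepr (x : M) : b.repr (P x) s =
      if (s.1.1.degree : ℤ) + deg s.1.2 = d then b.repr x s else 0 := by
    have : b.coord s ∘ₗ P = if (s.1.1.degree : ℤ) + deg s.1.2 = d then b.coord s else 0 := by
      refine b.ext fun t => ?_
      rw [LinearMap.comp_apply, hPb]
      by_cases hts : t = s
      · subst hts; split_ifs <;> simp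
      · split_ifs <;> simp [hts]
    have := LinearMap.congr_fun this x
    rw [LinearMap.comp_apply, b.coord_apply] at this
    rw [this]
    split_ifs <;> simp
  by_contra hne
  have := hrepr m
  rw [hP, DirectSum.decompose_of_mem_same ℳ hm, if_neg hne] at this
  exact hs this

end StandardBasis

/-! ### The based complex -/

section BasedComplex

variable {k : Type*} [Field k] {n : ℕ} {M : Type*} [AddCommGroup M] [Module k M]
  {T : Type*} (b : Module.Basis T k M)

lemma koszulBasis_apply (p : ℕ) (v : Σ _ : {I : Finset (Fin n) // I.card = p}, T) :
    koszulBasis b p v = elemE k n p v.1.1 (b v.2) := by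
  rw [koszulBasis, Finsupp.coe_basis, elemE, inclE_apply k n M v.1.2]
  simp

open Classical in
lemma koszulBasis_repr_elemE (p : ℕ) (I : Finset (Fin n)) (m : M)
    (w : Σ _ : {I : Finset (Fin n) // I.card = p}, T) :
    (koszulBasis b p).repr (elemE k n p I m) w =
      if w.1.1 = I then MvPolynomial.C (b.repr m w.2) else 0 := by
  by_cases hI : I.card = p
  · rw [elemE, inclE_apply k n M hI, koszulBasis, Finsupp.basis_repr, Finsupp.single_apply]
    by_cases h : w.1.1 = I
    · rw [if_pos (Subtype.ext h.symm), if_pos h, Algebra.TensorProduct.basis_repr_tmul]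
      simp [MvPolynomial.algebraMap_eq]
    · rw [if_neg fun h' => h (by rw [← h']), if_neg h]
      simp
  · rw [elemE, inclE_eq_zero k n M hI, if_neg fun h => hI (by rw [← h, w.1.2])]
    simp

variable [Module (Poly k n) M] [IsScalarTower k (Poly k n) M]

lemma koszulD_elemE (p : ℕ) (I : Finset (Fin n)) (m : M) :
    koszulD k n M p (elemE k n (p + 1) I m) =
      ∑ i ∈ I, sgn i I • ((MvPolynomial.X i : Poly k n) • elemE k n p (I.erase i) m -
        elemE k n p (I.erase i) ((MvPolynomial.X i : Poly k n) • m)) := by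
  rw [elemE, koszulD_inclE]
  refine Finset.sum_congr rfl fun i _ => ?_
  rw [elemE, elemE, diffOp, ← (inclE k n M p (I.erase i)).map_smul, ← map_sub]
  simp [rightMul]

open Classical in
lemma koszulBasis_repr_koszulD (p : ℕ) (I : Finset (Fin n)) (m : M)
    (w : Σ _ : {I : Finset (Fin n) // I.card = p}, T) :
    (koszulBasis b p).repr (koszulD k n M p (elemE k n (p + 1) I m)) w =
      ∑ i ∈ I, sgn i I • if w.1.1 = I.erase i then
        MvPolynomial.X i * MvPolynomial.C (b.repr m w.2) -
          MvPolynomial.C (b.repr ((MvPolynomial.X i : Poly k n) • m) w.2) else 0 := by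
  rw [koszulD_elemE, map_sum, Finsupp.finsetSum_apply]
  refine Finset.sum_congr rfl fun i _ => ?_
  rw [map_zsmul, Finsupp.smul_apply, map_sub, Finsupp.sub_apply, map_smul, Finsupp.smul_apply,
    koszulBasis_repr_elemE, koszulBasis_repr_elemE]
  split_ifs <;> simp

end BasedComplex

/-! ### Vertices of the digraph -/

section Vertices

variable {k : Type*} [Field k] {n : ℕ} {ι : Type*}
  {M : Type*} [AddCommGroup M] [Module k M] [Module (Poly k n) M]
  [IsScalarTower k (Poly k n) M]
  {ord : TermOrder n ι} {η : (ι →₀ Poly k n) →ₗ[Poly k n] M}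

/-- The product `x_i t` of a standard term by a non-critical variable. -/
def StdTerm.mulX (t : StdTerm ord η) (i : Fin n) (hi : i ∉ crit ord η t.1.2) : StdTerm ord η :=
  ⟨(t.1.1 + Finsupp.single i 1, t.1.2), fun l hl => by
    classical
    rcases Finset.mem_union.mp (Finsupp.support_add hl) with h | h
    · exact t.2 l h
    · rw [Finset.mem_singleton.mp (Finsupp.support_single_subset h)]
      exact hi⟩

/-- The quotient `t / x_i` of a standard term by a variable. -/
def StdTerm.divX (t : StdTerm ord η) (i : Fin n) : StdTerm ord η :=
  ⟨(t.1.1 - Finsupp.single i 1, t.1.2), fun l hl => t.2 l <| by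
    rw [Finsupp.mem_support_iff] at hl ⊢
    rw [Finsupp.tsub_apply] at hl
    omega⟩

lemma sub_single_add_single {α : Fin n →₀ ℕ} {i : Fin n} (hi : i ∈ α.support) :
    α - Finsupp.single i 1 + Finsupp.single i 1 = α := by
  refine tsub_add_cancel_of_le ?_
  rw [Finsupp.single_le_iff]
  have := Finsupp.mem_support_iff.mp hi
  omega

lemma mem_support_add_single (α : Fin n →₀ ℕ) (i l : Fin n) :
    l ∈ (α + Finsupp.single i 1).support ↔ l = i ∨ l ∈ α.support := by
  rw [Finsupp.mem_support_iff, Finsupp.mem_support_iff, Finsupp.add_apply, Finsupp.single_apply]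
  by_cases h : i = l
  · simp [h]
  · simp [h, Ne.symm h]

variable (ord η) in
/-- The vertices of all homological degrees. -/
abbrev Vtx : Type _ := Σ p, Vertex ord η p

lemma vtx_ext {x y : Vtx ord η} (hI : x.2.1.1 = y.2.1.1) (ht : x.2.2.1 = y.2.2.1) : x = y := by
  obtain ⟨p, ⟨⟨I, hIp⟩, t⟩⟩ := x
  obtain ⟨q, ⟨⟨J, hJq⟩, s⟩⟩ := y
  obtain rfl : I = J := hI
  obtain rfl : p = q := hIp.symm.trans hJq
  obtain rfl : t = s := Subtype.ext ht
  rfl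

lemma vertex_ext {p : ℕ} {v w : Vertex ord η p} (hI : v.1.1 = w.1.1) (ht : v.2.1 = w.2.1) :
    v = w :=
  eq_of_heq (Sigma.mk.inj (vtx_ext (x := ⟨p, v⟩) (y := ⟨p, w⟩) hI ht)).2

/-- The set `(I ∪ supp α) ∩ ncrit(g_j)` of a vertex `e_I x^α g_j`. -/
def ncritSet (x : Vtx ord η) : Set (Fin n) :=
  ((x.2.1.1 ∪ x.2.2.1.1.support : Finset (Fin n)) : Set (Fin n)) ∩ (crit ord η x.2.2.1.2)ᶜ

lemma mem_ncritSet {x : Vtx ord η} {i : Fin n} :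
    i ∈ ncritSet x ↔ (i ∈ x.2.1.1 ∨ i ∈ x.2.2.1.1.support) ∧ i ∉ crit ord η x.2.2.1.2 := by
  simp only [ncritSet, Set.mem_inter_iff, Finset.mem_coe, Finset.mem_union, Set.mem_compl_iff]

lemma exists_isGreatest_ncritSet {x : Vtx ord η} (h : (ncritSet x).Nonempty) :
    ∃ i, IsGreatest (ncritSet x) i := by
  obtain ⟨i, hi, hmax⟩ := Set.exists_max_image (ncritSet x) id (Set.toFinite _) h
  exact ⟨i, hi, hmax⟩

lemma matching_iff {x y : Vtx ord η} :
    Matching ord η x y ↔ ∃ i ∈ x.2.1.1, IsGreatest (ncritSet x) i ∧ y.2.1.1 = x.2.1.1.erase i ∧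
      y.2.2.1 = (x.2.2.1.1 + Finsupp.single i 1, x.2.2.1.2) := by
  constructor
  · rintro ⟨p, v, w, i, hi, hmax, hI, ht⟩
    exact ⟨i, hi, hmax, hI, ht⟩
  · rintro ⟨i, hi, hmax, hI, ht⟩
    obtain ⟨p, v⟩ := x
    obtain ⟨q, w⟩ := y
    have h1 := Finset.card_erase_add_one hi
    rw [← hI, w.1.2, v.1.2] at h1
    subst h1
    exact Matching.mk q v w i hi hmax hI ht

/-- The index `i` only moves from `I` to the support of `α`, so `ncritSet` does not change. -/
lemma isGreatest_of_matching {x y : Vtx ord η} {i : Fin n} (hi : i ∈ x.2.1.1)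
    (hmax : IsGreatest (ncritSet x) i) (hI : y.2.1.1 = x.2.1.1.erase i)
    (ht : y.2.2.1 = (x.2.2.1.1 + Finsupp.single i 1, x.2.2.1.2)) :
    IsGreatest (ncritSet y) i := by
  have : ncritSet y = ncritSet x := by
    ext l
    rw [mem_ncritSet, mem_ncritSet, hI, ht, mem_support_add_single, Finset.mem_erase]
    by_cases hl : l = i
    · subst hl; simp [hi]
    · simp [hl]
  rwa [this]

/-- Either end determines `i` as the maximum of its `ncritSet`. It lies in `I` at upper ends and not
at lower ends, so no vertex is both. -/
lemma matching_unique {x y x' y' : Vtx ord η} (h : Matching ord η x y)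
    (h' : Matching ord η x' y') (hxy : x = x' ∨ x = y' ∨ y = x' ∨ y = y') : x = x' ∧ y = y' := by
  obtain ⟨i, hi, hmax, hI, ht⟩ := matching_iff.mp h
  obtain ⟨i', hi', hmax', hI', ht'⟩ := matching_iff.mp h'
  have hy := isGreatest_of_matching hi hmax hI ht
  have hy' := isGreatest_of_matching hi' hmax' hI' ht'
  rcases hxy with rfl | rfl | rfl | rfl
  · obtain rfl := hmax.unique hmax'
    exact ⟨rfl, vtx_ext (hI.trans hI'.symm) (ht.trans ht'.symm)⟩
  · obtain rfl := hmax.unique hy'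
    rw [hI'] at hi
    exact absurd hi (Finset.notMem_erase _ _)
  · obtain rfl := hmax'.unique hy
    rw [hI] at hi'
    exact absurd hi' (Finset.notMem_erase _ _)
  · obtain rfl := hy.unique hy'
    refine ⟨vtx_ext ?_ ?_, rfl⟩
    · rw [← Finset.insert_erase hi, ← hI, hI', Finset.insert_erase hi']
    · rw [ht] at ht'
      obtain ⟨h1, h2⟩ := Prod.ext_iff.mp ht'
      exact Prod.ext (add_right_cancel h1) h2

/-- A vertex that is matched downwards. -/
def IsUpper (x : Vtx ord η) : Prop := ∃ i ∈ x.2.1.1, IsGreatest (ncritSet x) i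

lemma exists_matching_of_isUpper {p : ℕ} {v : Vertex ord η p} (h : IsUpper ⟨p, v⟩) :
    ∃ y, Matching ord η ⟨p, v⟩ y := by
  obtain ⟨i, hi, hmax⟩ := h
  exact ⟨⟨_, ⟨⟨_, rfl⟩, StdTerm.mulX v.2 i hmax.1.2⟩⟩, matching_iff.mpr ⟨i, hi, hmax, rfl, rfl⟩⟩

/-- Identifies the vertices on which `φ` is given by the recursion with the lower ends of the
matching. -/
lemma isLiftIndex_iff {x : Vtx ord η} {i : Fin n} :
    IsLiftIndex ord η x.2.1.1 x.2.2.1 i ↔ IsGreatest (ncritSet x) i ∧ i ∉ x.2.1.1 := by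
  constructor
  · rintro ⟨⟨hi, hmax⟩, hlt⟩
    have hc := x.2.2.2 i hi
    refine ⟨⟨mem_ncritSet.mpr ⟨Or.inr hi, hc⟩, fun l hl => ?_⟩, fun hiI => (hlt i hiI hc).ne rfl⟩
    obtain ⟨h | h, hlc⟩ := mem_ncritSet.mp hl
    · exact (hlt l h hlc).le
    · exact hmax h
  · rintro ⟨⟨hi, hmax⟩, hiI⟩
    obtain ⟨h | h, hc⟩ := mem_ncritSet.mp hi
    · exact absurd h hiI
    · refine ⟨⟨h, fun l hl => hmax (mem_ncritSet.mpr ⟨Or.inr hl, x.2.2.2 l hl⟩)⟩,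
        fun l hl hlc => lt_of_le_of_ne (hmax (mem_ncritSet.mpr ⟨Or.inl hl, hlc⟩)) ?_⟩
      rintro rfl
      exact hiI hl

/-- The vertex `e_{I ∪ i} (x^α / x_i) g_j` for a vertex `e_I x^α g_j`. -/
def liftVertex {p : ℕ} (v : Vertex ord η p) (i : Fin n) (hi : i ∉ v.1.1) : Vertex ord η (p + 1) :=
  ⟨⟨insert i v.1.1, by rw [Finset.card_insert_of_notMem hi, v.1.2]⟩, v.2.divX i⟩

lemma IsLiftIndex.notMem {p : ℕ} {v : Vertex ord η p} {i : Fin n}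
    (h : IsLiftIndex ord η v.1.1 v.2.1 i) : i ∉ v.1.1 :=
  ((isLiftIndex_iff (x := ⟨p, v⟩)).mp h).2

lemma matching_liftVertex {p : ℕ} {v : Vertex ord η p} {i : Fin n}
    (h : IsLiftIndex ord η v.1.1 v.2.1 i) :
    Matching ord η ⟨p + 1, liftVertex v i h.notMem⟩ ⟨p, v⟩ := by
  have hi : i ∈ v.2.1.1.support := h.1.1
  have hmax := ((isLiftIndex_iff (x := ⟨p, v⟩)).mp h).1
  have hset : ncritSet (⟨p + 1, liftVertex v i h.notMem⟩ : Vtx ord η) = ncritSet ⟨p, v⟩ := by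
    ext l
    rw [mem_ncritSet, mem_ncritSet]
    refine and_congr ?_ Iff.rfl
    have := mem_support_add_single (v.2.1.1 - Finsupp.single i 1) i l
    rw [sub_single_add_single hi] at this
    simp only [liftVertex, StdTerm.divX, Finset.mem_insert]
    rw [this]
    tauto
  refine matching_iff.mpr ⟨i, Finset.mem_insert_self _ _, hset ▸ hmax, ?_, ?_⟩
  · exact (Finset.erase_insert h.notMem).symm
  · exact Prod.ext (sub_single_add_single hi).symm rfl

lemma exists_isLiftIndex_of_matching {p q : ℕ} {v : Vertex ord η p} {x : Vertex ord η q}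
    (h : Matching ord η ⟨q, x⟩ ⟨p, v⟩) : ∃ i, IsLiftIndex ord η v.1.1 v.2.1 i := by
  obtain ⟨i, hi, hmax, hI, ht⟩ := matching_iff.mp h
  refine ⟨i, (isLiftIndex_iff (x := ⟨p, v⟩)).mpr ⟨isGreatest_of_matching hi hmax hI ht, ?_⟩⟩
  rw [hI]
  exact Finset.notMem_erase _ _

lemma ncritSet_eq_empty_iff {p : ℕ} (v : Vertex ord η p) :
    ncritSet ⟨p, v⟩ = ∅ ↔ v.2.1.1 = 0 ∧ ∀ i ∈ v.1.1, i ∈ crit ord η v.2.1.2 := by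
  rw [Set.eq_empty_iff_forall_notMem]
  constructor
  · intro h
    refine ⟨?_, fun i hi => ?_⟩
    · rw [← Finsupp.support_eq_empty, Finset.eq_empty_iff_forall_notMem]
      exact fun i hi => h i (mem_ncritSet.mpr ⟨Or.inr hi, v.2.2 i hi⟩)
    · by_contra hc
      exact h i (mem_ncritSet.mpr ⟨Or.inl hi, hc⟩)
  · rintro ⟨h0, hI⟩ i hi
    obtain ⟨h | h, hc⟩ := mem_ncritSet.mp hi
    · exact hc (hI i h)
    · simp only [h0, Finsupp.support_zero, Finset.notMem_empty] at h

lemma isUpper_or_isLiftIndex_or_ncritSet_eq_empty {p : ℕ} (v : Vertex ord η p) :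
    IsUpper ⟨p, v⟩ ∨ (∃ i, IsLiftIndex ord η v.1.1 v.2.1 i) ∨ ncritSet ⟨p, v⟩ = ∅ := by
  rcases (ncritSet ⟨p, v⟩).eq_empty_or_nonempty with h | h
  · exact Or.inr (Or.inr h)
  · obtain ⟨i, hi⟩ := exists_isGreatest_ncritSet h
    by_cases hiI : i ∈ v.1.1
    · exact Or.inl ⟨i, hiI, hi⟩
    · exact Or.inr (Or.inl ⟨i, (isLiftIndex_iff (x := ⟨p, v⟩)).mpr ⟨hi, hiI⟩⟩)

/-- The unmatched vertices are the `e_I g_j` with `I ⊆ crit(g_j)`. -/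
theorem isUnmatched_iff {p : ℕ} (v : Vertex ord η p) :
    IsUnmatched (Matching ord η) ⟨p, v⟩ ↔
      v.2.1.1 = 0 ∧ ∀ i ∈ v.1.1, i ∈ crit ord η v.2.1.2 := by
  rw [← ncritSet_eq_empty_iff]
  constructor
  · intro h
    rcases isUpper_or_isLiftIndex_or_ncritSet_eq_empty v with hu | ⟨i, hi⟩ | he
    · obtain ⟨y, hy⟩ := exists_matching_of_isUpper hu
      exact absurd hy (h y).1
    · exact absurd (matching_liftVertex hi) (h _).2
    · exact he
  · intro h y
    constructor
    · intro hy
      obtain ⟨i, -, hmax, -⟩ := matching_iff.mp hy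
      rw [h] at hmax
      exact hmax.1
    · intro hy
      obtain ⟨i, hi, hmax, hI, ht⟩ := matching_iff.mp hy
      have := isGreatest_of_matching hi hmax hI ht
      rw [h] at this
      exact this.1

/-! ### The order on the vertices -/

/-- The term `x^I x^α g_j` of a vertex `e_I x^α g_j`. -/
def vtxTerm (x : Vtx ord η) : Term n ι :=
  ((∑ i ∈ x.2.1.1, Finsupp.single i 1) + x.2.2.1.1, x.2.2.1.2)

/-- The order on the vertices: first by the term `x^I x^α g_j`, then by the sum of `I`, where
larger sums come first. -/
def vtxLT (x y : Vtx ord η) : Prop :=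
  ord.lt (vtxTerm x) (vtxTerm y) ∨ vtxTerm x = vtxTerm y ∧
    ∑ i ∈ y.2.1.1, (i : ℕ) < ∑ i ∈ x.2.1.1, (i : ℕ)

variable (ord η) in
lemma vtxLT_isStrictOrder (p : ℕ) :
    IsStrictOrder (Vertex ord η p) fun v w => vtxLT ⟨p, v⟩ ⟨p, w⟩ := by
  have := ord.isStrictTotalOrder
  refine { irrefl := ?_, trans := ?_ }
  · rintro v (h | h)
    · exact irrefl _ h
    · exact lt_irrefl _ h.2
  · rintro u v w (h | ⟨h, h'⟩) (g | ⟨g, g'⟩)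
    · exact Or.inl (_root_.trans h g)
    · exact Or.inl (g ▸ h)
    · exact Or.inl (h ▸ g)
    · exact Or.inr ⟨h.trans g, g'.trans h'⟩

variable (ord η) in
lemma vtxLT_wellFounded [Finite ι] (p : ℕ) :
    WellFounded fun v w : Vertex ord η p => vtxLT ⟨p, v⟩ ⟨p, w⟩ := by
  have hbound (v : Vertex ord η p) : ∑ i ∈ v.1.1, (i : ℕ) ≤ p * n := by
    have := Finset.sum_le_card_nsmul v.1.1 (fun i => (i : ℕ)) n fun i _ => i.2.le
    rwa [v.1.2, smul_eq_mul] at this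
  -- The sum of `I` is at most `p * n`, so its complement is a natural number that decreases as the
  -- sum grows.
  refine Subrelation.wf ?_ (InvImage.wf
    (fun v : Vertex ord η p => (vtxTerm ⟨p, v⟩, p * n - ∑ i ∈ v.1.1, (i : ℕ)))
    (ord.wellFounded.prod_lex (Nat.lt_wfRel.wf)))
  rintro v w (h | ⟨h, h'⟩)
  · exact Prod.Lex.left _ _ h
  · change Prod.Lex _ _ (vtxTerm ⟨p, v⟩, _) (vtxTerm ⟨p, w⟩, _)
    rw [h]
    refine Prod.Lex.right _ ?_
    have h1 := hbound v
    have h2 : ∑ i ∈ w.1.1, (i : ℕ) < ∑ i ∈ v.1.1, (i : ℕ) := h'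
    change p * n - _ < p * n - _
    omega

lemma sum_single_erase {I : Finset (Fin n)} {i : Fin n} (hi : i ∈ I) :
    (∑ l ∈ I.erase i, Finsupp.single l 1) + Finsupp.single i 1 =
      (∑ l ∈ I, Finsupp.single l 1 : Fin n →₀ ℕ) :=
  Finset.sum_erase_add _ _ hi

lemma vtxTerm_eq {x y : Vtx ord η} {i : Fin n} (hi : i ∈ x.2.1.1)
    (hI : y.2.1.1 = x.2.1.1.erase i)
    (ht : y.2.2.1 = (x.2.2.1.1 + Finsupp.single i 1, x.2.2.1.2)) : vtxTerm y = vtxTerm x := by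
  rw [vtxTerm, vtxTerm, hI, ht, ← sum_single_erase hi]
  exact Prod.ext (by dsimp only; abel) rfl

variable {b : Module.Basis (StdTerm ord η) k M}

/-- The product of a standard term and a variable is either standard or a combination of smaller
terms. -/
lemma repr_X_smul [Finite ι] (hb : ∀ t, b t = η (termVec k t.1)) {i : Fin n}
    {s t : StdTerm ord η} (h : b.repr ((MvPolynomial.X i : Poly k n) • b t) s ≠ 0) :
    (i ∉ crit ord η t.1.2 ∧ s.1 = (t.1.1 + Finsupp.single i 1, t.1.2)) ∨
      ord.lt s.1 (t.1.1 + Finsupp.single i 1, t.1.2) := by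
  rw [hb, X_smul_apply_termVec] at h
  by_cases hi : i ∈ crit ord η t.1.2
  · exact Or.inr (repr_lt_of_mem_crit (t := (t.1.1 + Finsupp.single i 1, t.1.2)) hb
      ((mem_support_add_single _ _ _).mpr (Or.inl rfl)) hi h)
  · refine Or.inl ⟨hi, ?_⟩
    have : b (t.mulX i hi) = η (termVec k (t.1.1 + Finsupp.single i 1, t.1.2)) := hb _
    rw [← this, b.repr_self] at h
    by_contra hne
    have hst : s ≠ t.mulX i hi := by
      rintro rfl
      exact hne rfl
    exact h (Finsupp.single_eq_of_ne hst)

/-- The summand `x_i e_{I ∖ i} m` loses the factor `x_i` of the term. The summand `e_{I ∖ i} x_i m`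
keeps the term if `i` is noncritical and is rewritten in smaller terms otherwise. -/
lemma edge_cases [Finite ι] (hb : ∀ t, b t = η (termVec k t.1)) {x y : Vtx ord η}
    (h : Edge (R := Poly k n) (K := Koszul k n M) (V := Vertex ord η) (koszulD k n M)
      (koszulBasis b) x y) :
    ord.lt (vtxTerm y) (vtxTerm x) ∨ ∃ i ∈ x.2.1.1, i ∉ crit ord η x.2.2.1.2 ∧
      y.2.1.1 = x.2.1.1.erase i ∧
      y.2.2.1 = (x.2.2.1.1 + Finsupp.single i 1, x.2.2.1.2) := by
  classical
  obtain ⟨p, v, w, h⟩ := h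
  rw [koszulBasis_apply, koszulBasis_repr_koszulD] at h
  obtain ⟨i, hi, hne⟩ := Finset.exists_ne_zero_of_sum_ne_zero h
  have hI : w.1.1 = v.1.1.erase i := by
    by_contra hI
    simp [hI] at hne
  rw [if_pos hI, b.repr_self] at hne
  have hterm : ((∑ l ∈ v.1.1.erase i, Finsupp.single l 1) +
      (v.2.1.1 + Finsupp.single i 1), v.2.1.2) = vtxTerm (⟨p + 1, v⟩ : Vtx ord η) := by
    rw [vtxTerm, ← sum_single_erase hi]
    exact Prod.ext (by dsimp only; abel) rfl
  by_cases hs : b.repr ((MvPolynomial.X i : Poly k n) • b v.2) w.2 = 0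
  · have hvw : w.2 = v.2 := by
      by_contra hvw
      simp [hs, Finsupp.single_eq_of_ne hvw] at hne
    left
    have := ord.lt_mul (Finsupp.single i 1) (vtxTerm (⟨p, w⟩ : Vtx ord η)) (by simp)
    rw [← hterm]
    convert this using 2
    · rw [vtxTerm, hI, hvw]
      dsimp only
      abel
    · rw [vtxTerm, hvw]
  · rcases repr_X_smul hb hs with ⟨hc, ht⟩ | hlt
    · exact Or.inr ⟨i, hi, hc, hI, ht⟩
    · left
      have := ord.mul_lt_mul (∑ l ∈ v.1.1.erase i, Finsupp.single l 1) _ _ hlt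
      rw [← hterm, vtxTerm, hI]
      exact this

lemma sum_erase_add_val {I : Finset (Fin n)} {i : Fin n} (hi : i ∈ I) :
    (∑ l ∈ I.erase i, (l : ℕ)) + i = ∑ l ∈ I, (l : ℕ) :=
  Finset.sum_erase_add _ _ hi

/-- If the term is kept, `w` arises from `v` by removing some `l` smaller than the matched index
`i`, which leaves a larger sum than removing `i`. -/
lemma vtxLT_of_matching_of_edge [Finite ι] (hb : ∀ t, b t = η (termVec k t.1))
    {u v w : Vtx ord η} (hvu : Matching ord η v u)
    (hvw : Edge (R := Poly k n) (K := Koszul k n M) (V := Vertex ord η) (koszulD k n M)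
      (koszulBasis b) v w) (hn : ¬ Matching ord η v w) : vtxLT w u := by
  obtain ⟨i, hi, hmax, hI, ht⟩ := matching_iff.mp hvu
  have hu := vtxTerm_eq hi hI ht
  rcases edge_cases hb hvw with h | ⟨l, hl, hlc, hlI, hlt⟩
  · exact Or.inl (hu ▸ h)
  · refine Or.inr ⟨(vtxTerm_eq hl hlI hlt).trans hu.symm, ?_⟩
    have hle : l ≤ i := hmax.2 (mem_ncritSet.mpr ⟨Or.inl hl, hlc⟩)
    have hne : l ≠ i := by
      rintro rfl
      exact hn (matching_iff.mpr ⟨l, hl, hmax, hlI, hlt⟩)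
    have h1 := sum_erase_add_val hi
    have h2 := sum_erase_add_val hl
    rw [hI, hlI]
    have : (l : ℕ) < i := lt_of_le_of_ne hle (Fin.val_ne_of_ne hne)
    omega

/-- If the term is kept, the removed index `l` lies in the support of `v`, so `l ≤ i`; equality
would give `u = w`. Thus `w` exchanges `l` for a larger index. -/
lemma vtxLT_of_edge_of_matching [Finite ι] (hb : ∀ t, b t = η (termVec k t.1))
    {u v w : Vtx ord η} (hwv : Matching ord η w v)
    (huv : Edge (R := Poly k n) (K := Koszul k n M) (V := Vertex ord η) (koszulD k n M)
      (koszulBasis b) u v) (hn : ¬ Matching ord η u v) : vtxLT w u := by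
  obtain ⟨i, hi, hmax, hI, ht⟩ := matching_iff.mp hwv
  have hw := vtxTerm_eq hi hI ht
  rcases edge_cases hb huv with h | ⟨l, hl, hlc, hlI, hlt⟩
  · exact Or.inl (hw ▸ h)
  · refine Or.inr ⟨hw.symm.trans (vtxTerm_eq hl hlI hlt), ?_⟩
    obtain ⟨h1, h2⟩ := Prod.ext_iff.mp (hlt.symm.trans ht)
    dsimp only at h1 h2
    have hne : l ≠ i := by
      rintro rfl
      have huw : u = w := vtx_ext
        (by rw [← Finset.insert_erase hl, ← hlI, hI, Finset.insert_erase hi])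
        (Prod.ext (add_right_cancel h1) h2)
      exact hn (huw ▸ hwv)
    have hlw : l ∈ w.2.2.1.1.support := by
      have := (mem_support_add_single u.2.2.1.1 l l).mpr (Or.inl rfl)
      rw [h1, mem_support_add_single] at this
      exact this.resolve_left hne
    have hle : l ≤ i := hmax.2 (mem_ncritSet.mpr ⟨Or.inr hlw, w.2.2.2 l hlw⟩)
    have h3 := sum_erase_add_val hi
    have h4 := sum_erase_add_val hl
    rw [← hI] at h3
    rw [← hlI] at h4
    have : (l : ℕ) < i := lt_of_le_of_ne hle (Fin.val_ne_of_ne hne)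
    omega

lemma Edge.degree {R : Type*} [CommRing R] {K : ℕ → Type*} [∀ p, AddCommGroup (K p)]
    [∀ p, Module R (K p)] {V : ℕ → Type*} {d : ∀ p, K (p + 1) →ₗ[R] K p}
    {bas : ∀ p, Module.Basis (V p) R (K p)} {x y : Σ p, V p} (h : Edge d bas x y) :
    x.1 = y.1 + 1 := by
  cases h; rfl

lemma Matching.degree {x y : Vtx ord η} (h : Matching ord η x y) : x.1 = y.1 + 1 := by
  cases h; rfl

/-- Only the summand of `i` reaches `I ∖ i`, and its part `x_i e_{I ∖ i} m` misses `w` because the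
two standard terms differ. -/
lemma koszulD_repr_of_matching (hb : ∀ t, b t = η (termVec k t.1)) {p : ℕ}
    {v : Vertex ord η (p + 1)} {w : Vertex ord η p} {i : Fin n} (hi : i ∈ v.1.1)
    (hI : w.1.1 = v.1.1.erase i)
    (ht : w.2.1 = (v.2.1.1 + Finsupp.single i 1, v.2.1.2)) :
    (koszulBasis b p).repr (koszulD k n M p (koszulBasis b (p + 1) v)) w =
      ((-sgn i v.1.1 : ℤ) : Poly k n) := by
  classical
  rw [koszulBasis_apply, koszulBasis_repr_koszulD, Finset.sum_eq_single_of_mem i hi, if_pos hI,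
    b.repr_self]
  · have hwv : w.2 ≠ v.2 := by
      intro h
      rw [h] at ht
      have := DFunLike.congr_fun (Prod.ext_iff.mp ht).1 i
      simp at this
    have hX : (MvPolynomial.X i : Poly k n) • b v.2 = b w.2 := by
      rw [hb, hb, X_smul_apply_termVec, ht]
    rw [Finsupp.single_eq_of_ne hwv, hX, b.repr_self]
    simp
  · intro l hl hne
    rw [if_neg, smul_zero]
    intro h
    rw [hI] at h
    exact Finset.notMem_erase l v.1.1 (h ▸ Finset.mem_erase.mpr ⟨hne, hl⟩)

lemma isUnit_intCast_sgn (i : Fin n) (I : Finset (Fin n)) :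
    IsUnit ((sgn i I : ℤ) : Poly k n) := by
  refine IsUnit.of_mul_eq_one ((sgn i I : ℤ) : Poly k n) ?_
  rw [← Int.cast_mul, sgn_mul_self, Int.cast_one]

/-- The matching on the two-sided Koszul complex is a Morse matching. -/
theorem isMorseMatching [Finite ι] (hb : ∀ t, b t = η (termVec k t.1)) :
    IsMorseMatching (R := Poly k n) (K := Koszul k n M) (V := Vertex ord η)
      (koszulD k n M) (koszulBasis b) (Matching ord η) where
  edge x y h := by
    obtain ⟨p, v, w, i, hi, hmax, hI, ht⟩ := h
    refine Edge.mk p v w ?_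
    rw [koszulD_repr_of_matching hb hi hI ht, Int.cast_neg, neg_ne_zero]
    exact (isUnit_intCast_sgn i v.1.1).ne_zero
  matching x y x' y' := matching_unique
  isUnit p v w h := by
    obtain ⟨i, hi, hmax, hI, ht⟩ := matching_iff.mp h
    rw [koszulD_repr_of_matching hb hi hI ht, Int.cast_neg]
    exact (isUnit_intCast_sgn i v.1.1).neg
  wellFounded p := by
    refine ⟨_, vtxLT_isStrictOrder ord η p, vtxLT_wellFounded ord η p, fun u w v huv hvw => ?_⟩
    -- Two steps down or two steps up do not return to degree `p`.
    rcases huv with ⟨huv, hn⟩ | hvu <;> rcases hvw with ⟨hvw, hn'⟩ | hwv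
    · have h1 := huv.degree
      have h2 := hvw.degree
      dsimp only at h1 h2
      omega
    · exact vtxLT_of_edge_of_matching hb hwv huv hn
    · exact vtxLT_of_matching_of_edge hb hvu hvw hn'
    · have h1 := hvu.degree
      have h2 := hwv.degree
      dsimp only at h1 h2
      omega

end Vertices

/-! ### The Morse complex of a free resolution -/

section MorseComplex

variable {R : Type*} [CommRing R] {M : Type*} [AddCommGroup M] [Module R M]
  {K : ℕ → Type*} [∀ p, AddCommGroup (K p)] [∀ p, Module R (K p)]
  {G : ℕ → Type*} [∀ p, AddCommGroup (G p)] [∀ p, Module R (G p)]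

/-- A homotopy `φ` on a complex `K` that splits off the summand generated by the submodules `D p`,
leaving the summands `G p`. -/
structure IsMorseSplitting (d : ∀ p, K (p + 1) →ₗ[R] K p) (φ : ∀ p, K p →ₗ[R] K (p + 1))
    (D : ∀ p, Submodule R (K p)) (i : ∀ p, G p →ₗ[R] K p) (π : ∀ p, K p →ₗ[R] G p) : Prop where
  homotopy_mem : ∀ p x, φ p x ∈ D (p + 1)
  homotopy_d : ∀ p, ∀ x ∈ D (p + 1), φ p (d p x) = x
  homotopy_eq_zero : ∀ p, ∀ x ∈ D p, φ p x = 0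
  homotopy_incl : ∀ p g, φ p (i p g) = 0
  proj_incl : ∀ p g, π p (i p g) = g
  proj_eq_zero : ∀ p, ∀ x ∈ D p, π p x = 0
  bot : ∀ x ∈ D 0, x = 0
  decomp : ∀ p x, ∃ a ∈ D p, ∃ g, ∃ c ∈ D (p + 1), x = a + i p g + d p c

namespace IsMorseSplitting

variable {d : ∀ p, K (p + 1) →ₗ[R] K p} {φ : ∀ p, K p →ₗ[R] K (p + 1)}
  {D : ∀ p, Submodule R (K p)} {i : ∀ p, G p →ₗ[R] K p} {π : ∀ p, K p →ₗ[R] G p}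
  (h : IsMorseSplitting d φ D i π)

include h

lemma homotopy_homotopy (p : ℕ) (x : K p) : φ (p + 1) (φ p x) = 0 :=
  h.homotopy_eq_zero _ _ (h.homotopy_mem p x)

lemma proj_sub (p : ℕ) (g : G (p + 1)) (x : K p) : π (p + 1) (i (p + 1) g - φ p x) = g := by
  rw [map_sub, h.proj_incl, h.proj_eq_zero _ _ (h.homotopy_mem p x), sub_zero]

lemma exists_zero (x : K 0) : ∃ g, x - d 0 (φ 0 x) = i 0 g := by
  obtain ⟨a, ha, g, c, hc, rfl⟩ := h.decomp 0 x
  refine ⟨g, ?_⟩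
  simp only [h.bot a ha, map_add, map_zero, h.homotopy_incl, h.homotopy_d 0 c hc]
  abel

/-- The map `1 - d φ - φ d` kills `D` and `d D`, so only the `G`-part of `x` survives. In degree `0`
the term `φ d` is absent and `D` is zero. -/
lemma exists_succ (hd : ∀ p x, d p (d (p + 1) x) = 0) (p : ℕ) (x : K (p + 1)) :
    ∃ g, x - d (p + 1) (φ (p + 1) x) - φ p (d p x) =
      i (p + 1) g - φ p (d p (i (p + 1) g)) := by
  obtain ⟨a, ha, g, c, hc, rfl⟩ := h.decomp (p + 1) x
  refine ⟨g, ?_⟩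
  simp only [map_add, h.homotopy_incl, h.homotopy_d _ c hc, h.homotopy_eq_zero _ a ha,
    h.homotopy_d _ a ha, hd, map_zero]
  abel

lemma incl_diff_zero (g : G 1) :
    i 0 (π 0 (d 0 (i 1 g) - d 0 (φ 0 (d 0 (i 1 g))))) =
      d 0 (i 1 g) - d 0 (φ 0 (d 0 (i 1 g))) := by
  obtain ⟨g', hg'⟩ := h.exists_zero (d 0 (i 1 g))
  rw [hg', h.proj_incl]

/-- Says that `g ↦ i g - φ d i g` is a chain map from the Morse complex to `K`. By `proj_sub` it has
the left inverse `π`. -/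
lemma incl_diff_succ (hd : ∀ p x, d p (d (p + 1) x) = 0) (p : ℕ) (g : G (p + 2)) :
    let y := d (p + 1) (i (p + 2) g) - d (p + 1) (φ (p + 1) (d (p + 1) (i (p + 2) g)))
    i (p + 1) (π (p + 1) y) - φ p (d p (i (p + 1) (π (p + 1) y))) = y := by
  intro y
  obtain ⟨g', hg'⟩ := h.exists_succ hd p (d (p + 1) (i (p + 2) g))
  rw [hd, map_zero, sub_zero] at hg'
  change y = _ at hg'
  have : π (p + 1) y = g' := by rw [hg', h.proj_sub]
  rw [this, hg']

lemma diff_eq_zero (hd : ∀ p x, d p (d (p + 1) x) = 0) (p : ℕ) (g : G (p + 1))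
    (hg : π p (d p (i (p + 1) g) - d p (φ p (d p (i (p + 1) g)))) = 0) :
    d p (i (p + 1) g) - d p (φ p (d p (i (p + 1) g))) = 0 := by
  cases p with
  | zero => rw [← h.incl_diff_zero g, hg, map_zero]
  | succ p =>
    have := h.incl_diff_succ hd p g
    dsimp only at this
    rw [hg] at this
    simpa using this.symm

/-- The Morse complex of a free resolution is a free resolution. -/
theorem isFreeResolution {ε : K 0 →ₗ[R] M} (hK : IsFreeResolution d ε)
    (hG : ∀ p, Module.Free R (G p)) :
    IsFreeResolution (fun p => π p ∘ₗ (d p - d p ∘ₗ φ p ∘ₗ d p) ∘ₗ i (p + 1)) (ε ∘ₗ i 0) := by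
  have hd (p : ℕ) (x : K (p + 2)) : d p (d (p + 1) x) = 0 := (hK.exact_succ p).apply_apply_eq_zero x
  have hε (x : K 1) : ε (d 0 x) = 0 := hK.exact_zero.apply_apply_eq_zero x
  -- A preimage `x` in `K` may be replaced by `x - d φ x - φ d x`: its boundary is the same because
  -- `φ` kills `d x`, and it comes from some `g'` in `G`.
  have hlift (p : ℕ) (g : G (p + 1)) (x : K (p + 2))
      (hx : d (p + 1) x = i (p + 1) g - φ p (d p (i (p + 1) g))) :
      ∃ g', π (p + 1) (d (p + 1) (i (p + 2) g') -
        d (p + 1) (φ (p + 1) (d (p + 1) (i (p + 2) g')))) = g := by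
    obtain ⟨g', hg'⟩ := h.exists_succ hd (p + 1) x
    have := congrArg (fun z => π (p + 1) (d (p + 1) z)) hg'
    refine ⟨g', ?_⟩
    rw [← map_sub, ← this, (d (p + 1)).map_sub, (d (p + 1)).map_sub, hd, sub_zero, hx,
      (φ (p + 1)).map_sub, h.homotopy_incl,
      h.homotopy_homotopy, sub_zero, map_zero, sub_zero, h.proj_sub]
  refine { free := hG, surjective := ?_, exact_zero := ?_, exact_succ := ?_ }
  · intro m
    obtain ⟨x, rfl⟩ := hK.surjective m
    obtain ⟨g, hg⟩ := h.exists_zero x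
    refine ⟨g, ?_⟩
    rw [LinearMap.comp_apply, ← hg, map_sub, hε, sub_zero]
  · intro g
    simp only [Set.mem_range, LinearMap.comp_apply, LinearMap.sub_apply]
    constructor
    · intro hg
      obtain ⟨x, hx⟩ := (hK.exact_zero _).mp hg
      obtain ⟨g', hg'⟩ := h.exists_succ hd 0 x
      have := congrArg (fun z => π 0 (d 0 z)) hg'
      refine ⟨g', ?_⟩
      rw [← map_sub, ← this, (d 0).map_sub, (d 0).map_sub, hd, sub_zero, hx, h.homotopy_incl, map_zero,
        sub_zero, h.proj_incl]
    · rintro ⟨g', rfl⟩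
      rw [h.incl_diff_zero, map_sub, hε, hε, sub_zero]
  · intro p g
    simp only [Set.mem_range, LinearMap.comp_apply, LinearMap.sub_apply]
    constructor
    · intro hg
      have hy := h.diff_eq_zero hd p g hg
      rw [← map_sub] at hy
      obtain ⟨x, hx⟩ := (hK.exact_succ p _).mp hy
      exact hlift p g x hx
    · rintro ⟨g', rfl⟩
      have key := (congrArg (d p) (h.incl_diff_succ hd p g')).trans
        (by rw [(d p).map_sub, hd, hd, sub_zero])
      rw [(d p).map_sub] at key
      rw [key, map_zero]

end IsMorseSplitting

end MorseComplex

section Homotopy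

variable {k : Type*} [Field k] {n : ℕ} {ι : Type*}
  {M : Type*} [AddCommGroup M] [Module k M] [Module (Poly k n) M]
  [IsScalarTower k (Poly k n) M]
  {ord : TermOrder n ι} {η : (ι →₀ Poly k n) →ₗ[Poly k n] M}
  {b : Module.Basis (StdTerm ord η) k M}

lemma mem_of_repr_ne_zero {R V N : Type*} [CommRing R] [AddCommGroup N] [Module R N]
    (B : Module.Basis V R N) {W : Submodule R N} {x : N}
    (h : ∀ v, B.repr x v ≠ 0 → B v ∈ W) : x ∈ W := by
  rw [← B.linearCombination_repr x]
  exact Submodule.sum_mem _ fun v hv =>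
    W.smul_mem _ (h v (Finsupp.mem_support_iff.mp hv))

/-! ### The Morse homotopy -/

lemma phiZero_eq (hb : ∀ t, b t = η (termVec k t.1)) {p : ℕ} {v : Vertex ord η p} {i : Fin n}
    (h : IsLiftIndex ord η v.1.1 v.2.1 i) :
    phiZero η p v.1.1 v.2.1 i =
      -(sgn i (insert i v.1.1) • koszulBasis b (p + 1) (liftVertex v i h.notMem)) := by
  rw [koszulBasis_apply, hb]
  rfl

/-- The sign in `phiZero` makes the coefficient of `v` in `d (φ₀ v)` equal to `1`. What remains are
the other targets of the matched upper vertex, which are smaller. -/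
lemma vtxLT_of_repr_phiZero [Finite ι] (hb : ∀ t, b t = η (termVec k t.1)) {p : ℕ}
    {v w : Vertex ord η p} {i : Fin n} (h : IsLiftIndex ord η v.1.1 v.2.1 i)
    (hw : (koszulBasis b p).repr
      (koszulD k n M p (phiZero η p v.1.1 v.2.1 i) - koszulBasis b p v) w ≠ 0) :
    vtxLT ⟨p, w⟩ ⟨p, v⟩ := by
  have hm := matching_liftVertex h
  obtain ⟨l, hl, hmax, hI, ht⟩ := matching_iff.mp hm
  obtain rfl : l = i := hmax.unique (by
    have := isGreatest_of_matching hl hmax hI ht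
    exact (this.unique ((isLiftIndex_iff (x := ⟨p, v⟩)).mp h).1) ▸ hmax)
  rw [phiZero_eq hb h, map_neg, map_zsmul, map_sub, map_neg, map_zsmul, Finsupp.sub_apply,
    Finsupp.neg_apply, Finsupp.smul_apply, Module.Basis.repr_self] at hw
  by_cases hwv : w = v
  · subst hwv
    rw [koszulD_repr_of_matching hb hl hI ht, Finsupp.single_eq_same] at hw
    refine absurd ?_ hw
    change -(sgn l (insert l w.1.1) • ((-sgn l (insert l w.1.1) : ℤ) : Poly k n)) - 1 = 0
    rw [zsmul_eq_mul, ← Int.cast_mul, mul_neg, sgn_mul_self]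
    simp
  · rw [Finsupp.single_eq_of_ne hwv, sub_zero, neg_ne_zero] at hw
    have hne : (koszulBasis b p).repr
        (koszulD k n M p (koszulBasis b (p + 1) (liftVertex v l h.notMem))) w ≠ 0 := by
      intro h0
      rw [h0, smul_zero] at hw
      exact hw rfl
    refine vtxLT_of_matching_of_edge hb hm (Edge.mk p _ w hne) fun hn => hwv ?_
    have := (matching_unique hn hm (Or.inl rfl)).2
    exact eq_of_heq (Sigma.mk.inj this).2

open Classical in
variable (b) in
/-- The values of the Morse homotopy on the basis, by recursion on the order of the vertices. -/
def morseHomotopyAux [Finite ι] (p : ℕ) : Vertex ord η p → Koszul k n M (p + 1) :=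
  (vtxLT_wellFounded ord η p).fix fun v rec =>
    -- The inner default `0` is never reached, by `vtxLT_of_repr_phiZero`; the test only supplies
    -- the decrease that the recursion needs.
    if h : ∃ i, IsLiftIndex ord η v.1.1 v.2.1 i then
      phiZero η p v.1.1 v.2.1 h.choose -
        ((koszulBasis b p).repr (koszulD k n M p (phiZero η p v.1.1 v.2.1 h.choose) -
          koszulBasis b p v)).sum fun w c => c • if hw : vtxLT ⟨p, w⟩ ⟨p, v⟩ then rec w hw else 0
    else 0

variable (b) in
/-- The Morse homotopy. -/
def morseHomotopy [Finite ι] (p : ℕ) : Koszul k n M p →ₗ[Poly k n] Koszul k n M (p + 1) :=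
  (koszulBasis b p).constr (Poly k n) (morseHomotopyAux b p)

lemma IsLiftIndex.unique {I : Finset (Fin n)} {t : Term n ι} {i l : Fin n}
    (h : IsLiftIndex ord η I t i) (h' : IsLiftIndex ord η I t l) : i = l :=
  h.1.unique h'.1

lemma morseHomotopy_basis_of_isLiftIndex [Finite ι] (hb : ∀ t, b t = η (termVec k t.1)) {p : ℕ}
    {v : Vertex ord η p} {i : Fin n} (h : IsLiftIndex ord η v.1.1 v.2.1 i) :
    morseHomotopy b p (koszulBasis b p v) = phiZero η p v.1.1 v.2.1 i -
      morseHomotopy b p (koszulD k n M p (phiZero η p v.1.1 v.2.1 i) - koszulBasis b p v) := by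
  have hex : ∃ i, IsLiftIndex ord η v.1.1 v.2.1 i := ⟨i, h⟩
  have hi : hex.choose = i := hex.choose_spec.unique h
  rw [morseHomotopy, Module.Basis.constr_basis, Module.Basis.constr_apply, morseHomotopyAux,
    WellFounded.fix_eq, dif_pos hex, hi]
  congr 1
  refine Finsupp.sum_congr fun w hw => ?_
  rw [dif_pos (vtxLT_of_repr_phiZero hb h (Finsupp.mem_support_iff.mp hw))]

lemma morseHomotopy_basis_of_not [Finite ι] {p : ℕ} {v : Vertex ord η p}
    (h : ¬ ∃ i, IsLiftIndex ord η v.1.1 v.2.1 i) :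
    morseHomotopy b p (koszulBasis b p v) = 0 := by
  rw [morseHomotopy, Module.Basis.constr_basis, morseHomotopyAux, WellFounded.fix_eq, dif_neg h]

lemma isMorseHomotopy_iff (hb : ∀ t, b t = η (termVec k t.1))
    {φ : ∀ p, Koszul k n M p →ₗ[Poly k n] Koszul k n M (p + 1)} :
    IsMorseHomotopy ord η φ ↔
      (∀ (p : ℕ) (v : Vertex ord η p) (i : Fin n), IsLiftIndex ord η v.1.1 v.2.1 i →
        φ p (koszulBasis b p v) = phiZero η p v.1.1 v.2.1 i -
          φ p (koszulD k n M p (phiZero η p v.1.1 v.2.1 i) - koszulBasis b p v)) ∧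
      ∀ (p : ℕ) (v : Vertex ord η p), (¬ ∃ i, IsLiftIndex ord η v.1.1 v.2.1 i) →
        φ p (koszulBasis b p v) = 0 := by
  have he (p : ℕ) (v : Vertex ord η p) :
      koszulBasis b p v = elemE k n p v.1.1 (η (termVec k v.2.1)) := by
    rw [koszulBasis_apply, hb]
  simp only [he]
  constructor
  · intro h
    exact ⟨fun p v i hi => h.rec_eq p v.1.1 v.2 i v.1.2 hi,
      fun p v hv => h.eq_zero p v.1.1 v.2 v.1.2 hv⟩
  · intro h
    exact ⟨fun p I t i hI hi => h.1 p ⟨⟨I, hI⟩, t⟩ i hi, fun p I t hI ht => h.2 p ⟨⟨I, hI⟩, t⟩ ht⟩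

theorem isMorseHomotopy_morseHomotopy [Finite ι] (hb : ∀ t, b t = η (termVec k t.1)) :
    IsMorseHomotopy ord η (morseHomotopy b) :=
  (isMorseHomotopy_iff hb).mpr ⟨fun _ _ _ h => morseHomotopy_basis_of_isLiftIndex hb h,
    fun _ _ h => morseHomotopy_basis_of_not h⟩

theorem IsMorseHomotopy.unique [Finite ι] (hb : ∀ t, b t = η (termVec k t.1))
    {φ ψ : ∀ p, Koszul k n M p →ₗ[Poly k n] Koszul k n M (p + 1)}
    (hφ : IsMorseHomotopy ord η φ) (hψ : IsMorseHomotopy ord η ψ) : ψ = φ := by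
  rw [isMorseHomotopy_iff hb] at hφ hψ
  funext p
  refine (koszulBasis b p).ext fun v => ?_
  induction v using (vtxLT_wellFounded ord η p).induction with
  | _ v ih =>
  by_cases h : ∃ i, IsLiftIndex ord η v.1.1 v.2.1 i
  · obtain ⟨i, hi⟩ := h
    rw [hφ.1 p v i hi, hψ.1 p v i hi]
    congr 1
    -- The argument of the recursive call involves smaller vertices only, where the two maps agree.
    rw [← LinearMap.mem_eqLocus]
    exact mem_of_repr_ne_zero (koszulBasis b p) fun w hw => ih w (vtxLT_of_repr_phiZero hb hi hw)
  · rw [hφ.2 p v h, hψ.2 p v h]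

/-! ### The splitting of the two-sided Koszul complex -/

variable (b) in
/-- The submodule generated by the vertices that are matched downwards. -/
def upperSpan (p : ℕ) : Submodule (Poly k n) (Koszul k n M p) :=
  Submodule.span (Poly k n) (koszulBasis b p '' {v | IsUpper ⟨p, v⟩})

lemma not_isLiftIndex_of_isUpper {p : ℕ} {v : Vertex ord η p} (h : IsUpper ⟨p, v⟩) :
    ¬ ∃ i, IsLiftIndex ord η v.1.1 v.2.1 i := by
  rintro ⟨i, hi⟩
  obtain ⟨hmax, hn⟩ := (isLiftIndex_iff (x := ⟨p, v⟩)).mp hi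
  obtain ⟨l, hl, hmax'⟩ := h
  exact hn (hmax.unique hmax' ▸ hl)

lemma isUpper_liftVertex {p : ℕ} {v : Vertex ord η p} {i : Fin n}
    (h : IsLiftIndex ord η v.1.1 v.2.1 i) : IsUpper ⟨p + 1, liftVertex v i h.notMem⟩ := by
  obtain ⟨l, hl, hmax, -⟩ := matching_iff.mp (matching_liftVertex h)
  exact ⟨l, hl, hmax⟩

lemma phiZero_mem_upperSpan (hb : ∀ t, b t = η (termVec k t.1)) {p : ℕ} {v : Vertex ord η p}
    {i : Fin n} (h : IsLiftIndex ord η v.1.1 v.2.1 i) :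
    phiZero η p v.1.1 v.2.1 i ∈ upperSpan b (p + 1) := by
  rw [phiZero_eq hb h]
  have : koszulBasis b (p + 1) (liftVertex v i h.notMem) ∈ upperSpan b (p + 1) :=
    Submodule.subset_span ⟨_, isUpper_liftVertex h, rfl⟩
  exact neg_mem (zsmul_mem this _)

/-- The vertex of the basis element `e_I g_j`, `I ⊆ crit(g_j)`. -/
def CritCell.vertex {p : ℕ} (c : CritCell ord η p) : Vertex ord η p :=
  ⟨⟨c.1.1, c.2.1⟩, ⟨(0, c.1.2), fun i hi => by simp at hi⟩⟩

lemma CritCell.ncritSet_vertex {p : ℕ} (c : CritCell ord η p) :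
    ncritSet ⟨p, c.vertex⟩ = ∅ :=
  (ncritSet_eq_empty_iff _).mpr ⟨rfl, c.2.2⟩

lemma inclG_single (hb : ∀ t, b t = η (termVec k t.1)) {p : ℕ} (c : CritCell ord η p) :
    inclG ord η p (Finsupp.single c 1) = koszulBasis b p c.vertex := by
  rw [inclG, Finsupp.linearCombination_single, one_smul, koszulBasis_apply, hb]
  rfl

lemma projG_basis_vertex {p : ℕ} (c : CritCell ord η p) :
    projG ord η b p (koszulBasis b p c.vertex) = Finsupp.single c 1 := by
  rw [projG, Module.Basis.constr_basis, dif_pos ⟨rfl, c.2.2⟩]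
  rfl

lemma projG_basis_eq_zero {p : ℕ} {v : Vertex ord η p} (h : ncritSet ⟨p, v⟩ ≠ ∅) :
    projG ord η b p (koszulBasis b p v) = 0 := by
  rw [projG, Module.Basis.constr_basis, dif_neg]
  exact fun h' => h ((ncritSet_eq_empty_iff v).mpr h')

lemma exists_critCell {p : ℕ} {v : Vertex ord η p} (h : ncritSet ⟨p, v⟩ = ∅) :
    ∃ c : CritCell ord η p, c.vertex = v := by
  obtain ⟨h0, hI⟩ := (ncritSet_eq_empty_iff v).mp h
  exact ⟨⟨(v.1.1, v.2.1.2), v.1.2, hI⟩, vertex_ext rfl (Prod.ext h0.symm rfl)⟩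

/-- By linearity `φ v` cancels from both sides of the recursion, which leaves `φ d φ₀ v = φ₀ v`. -/
lemma IsMorseHomotopy.koszulD_phiZero (hb : ∀ t, b t = η (termVec k t.1))
    {φ : ∀ p, Koszul k n M p →ₗ[Poly k n] Koszul k n M (p + 1)}
    (hφ : IsMorseHomotopy ord η φ) {p : ℕ} {v : Vertex ord η p} {i : Fin n}
    (h : IsLiftIndex ord η v.1.1 v.2.1 i) :
    φ p (koszulD k n M p (phiZero η p v.1.1 v.2.1 i)) = phiZero η p v.1.1 v.2.1 i := by
  have := ((isMorseHomotopy_iff hb).mp hφ).1 p v i h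
  rw [map_sub, sub_sub_eq_add_sub, eq_sub_iff_add_eq] at this
  exact add_left_cancel (this.trans (add_comm _ _))

theorem IsMorseHomotopy.isMorseSplitting [Finite ι] (hb : ∀ t, b t = η (termVec k t.1))
    {φ : ∀ p, Koszul k n M p →ₗ[Poly k n] Koszul k n M (p + 1)}
    (hφ : IsMorseHomotopy ord η φ) :
    IsMorseSplitting (R := Poly k n) (K := Koszul k n M) (koszulD k n M) φ (upperSpan b)
      (inclG ord η) (projG ord η b) where
  homotopy_mem p x := by
    have hrec := (isMorseHomotopy_iff hb).mp hφ
    suffices ⊤ ≤ (upperSpan b (p + 1)).comap (φ p) from this (x := x) trivial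
    rw [← (koszulBasis b p).span_eq, Submodule.span_le]
    rintro _ ⟨v, rfl⟩
    induction v using (vtxLT_wellFounded ord η p).induction with
    | _ v ih =>
    change φ p (koszulBasis b p v) ∈ upperSpan b (p + 1)
    by_cases h : ∃ i, IsLiftIndex ord η v.1.1 v.2.1 i
    · obtain ⟨i, hi⟩ := h
      rw [hrec.1 p v i hi]
      refine sub_mem (phiZero_mem_upperSpan hb hi) ?_
      rw [← Submodule.mem_comap]
      exact mem_of_repr_ne_zero (koszulBasis b p) fun w hw =>
        ih w (vtxLT_of_repr_phiZero hb hi hw)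
    · rw [hrec.2 p v h]
      exact zero_mem _
  homotopy_d p x hx := by
    suffices upperSpan b (p + 1) ≤ LinearMap.eqLocus (φ p ∘ₗ koszulD k n M p) LinearMap.id from
      this hx
    rw [upperSpan, Submodule.span_le]
    rintro _ ⟨w, hw, rfl⟩
    change φ p (koszulD k n M p (koszulBasis b (p + 1) w)) = koszulBasis b (p + 1) w
    -- The upper vertex `w` is, up to sign, `φ₀` of its partner `v`.
    obtain ⟨⟨q, v⟩, hm⟩ := exists_matching_of_isUpper hw
    obtain rfl : p = q := by simpa using hm.degree
    obtain ⟨i, hi⟩ := exists_isLiftIndex_of_matching hm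
    have hwv : w = liftVertex v i hi.notMem :=
      eq_of_heq (Sigma.mk.inj (matching_unique hm (matching_liftVertex hi)
        (Or.inr (Or.inr (Or.inr rfl)))).1).2
    have h := hφ.koszulD_phiZero hb hi
    rw [phiZero_eq hb hi, ← hwv, map_neg, map_neg, map_zsmul, map_zsmul, neg_inj] at h
    have := congrArg (fun z => sgn i (insert i v.1.1) • z) h
    simpa only [smul_smul, sgn_mul_self, one_smul] using this
  homotopy_eq_zero p x hx := by
    suffices upperSpan b p ≤ LinearMap.ker (φ p) from this hx
    rw [upperSpan, Submodule.span_le]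
    rintro _ ⟨v, hv, rfl⟩
    exact ((isMorseHomotopy_iff hb).mp hφ).2 p v (not_isLiftIndex_of_isUpper hv)
  homotopy_incl p g := by
    suffices φ p ∘ₗ inclG ord η p = 0 from LinearMap.congr_fun this g
    refine Finsupp.basisSingleOne.ext fun c => ?_
    rw [Finsupp.coe_basisSingleOne, LinearMap.comp_apply, inclG_single hb, LinearMap.zero_apply]
    refine ((isMorseHomotopy_iff hb).mp hφ).2 p c.vertex ?_
    rintro ⟨i, hi⟩
    have := ((isLiftIndex_iff (x := ⟨p, c.vertex⟩)).mp hi).1.1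
    rw [c.ncritSet_vertex] at this
    exact this
  proj_incl p g := by
    suffices projG ord η b p ∘ₗ inclG ord η p = LinearMap.id from LinearMap.congr_fun this g
    refine Finsupp.basisSingleOne.ext fun c => ?_
    rw [Finsupp.coe_basisSingleOne, LinearMap.comp_apply, inclG_single hb, projG_basis_vertex,
      LinearMap.id_apply]
  proj_eq_zero p x hx := by
    suffices upperSpan b p ≤ LinearMap.ker (projG ord η b p) from this hx
    rw [upperSpan, Submodule.span_le]
    rintro _ ⟨v, ⟨i, -, hi⟩, rfl⟩
    exact projG_basis_eq_zero (Set.nonempty_iff_ne_empty.mp ⟨i, hi.1⟩)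
  bot x hx := by
    suffices upperSpan b 0 ≤ ⊥ from (Submodule.mem_bot _).mp (this hx)
    rw [upperSpan, Submodule.span_le]
    rintro _ ⟨v, ⟨i, hi, -⟩, rfl⟩
    have h0 : v.1.1 = ∅ := Finset.card_eq_zero.mp v.1.2
    change i ∈ v.1.1 at hi
    rw [h0] at hi
    simp at hi
  decomp p x := by
    let W := upperSpan b p ⊔ LinearMap.range (inclG ord η p) ⊔
      (upperSpan b (p + 1)).map (koszulD k n M p)
    suffices ⊤ ≤ W by
      obtain ⟨y, hy, _, ⟨c, hc, rfl⟩, rfl⟩ := Submodule.mem_sup.mp (this (x := x) trivial)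
      obtain ⟨a, ha, _, ⟨g, rfl⟩, rfl⟩ := Submodule.mem_sup.mp hy
      exact ⟨a, ha, g, c, hc, rfl⟩
    rw [← (koszulBasis b p).span_eq, Submodule.span_le]
    rintro _ ⟨v, rfl⟩
    induction v using (vtxLT_wellFounded ord η p).induction with
    | _ v ih =>
    rcases isUpper_or_isLiftIndex_or_ncritSet_eq_empty v with hu | ⟨i, hi⟩ | he
    · exact Submodule.mem_sup_left (Submodule.mem_sup_left (Submodule.subset_span ⟨v, hu, rfl⟩))
    -- A lower end `v` is `d (φ₀ v)`, which lies in `d D`, minus a combination of smaller vertices.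
    · have h1 : koszulD k n M p (phiZero η p v.1.1 v.2.1 i) ∈ W :=
        Submodule.mem_sup_right ⟨_, phiZero_mem_upperSpan hb hi, rfl⟩
      have h2 : koszulD k n M p (phiZero η p v.1.1 v.2.1 i) - koszulBasis b p v ∈ W :=
        mem_of_repr_ne_zero (koszulBasis b p) fun w hw => ih w (vtxLT_of_repr_phiZero hb hi hw)
      have := sub_mem h1 h2
      rwa [sub_sub_cancel] at this
    · obtain ⟨c, rfl⟩ := exists_critCell he
      exact Submodule.mem_sup_left (Submodule.mem_sup_right ⟨_, inclG_single hb c⟩)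

end Homotopy

/-! ### Homogeneous elements of based free modules -/

section Homogeneous

variable {k : Type*} [Field k] {n : ℕ} {N N' : Type*} [AddCommGroup N] [Module (Poly k n) N]
  [AddCommGroup N'] [Module (Poly k n) N'] {V V' : Type*}

/-- The homogeneous elements of degree `d` of the free module with basis `B`, where the basis
element `v` has degree `deg v`. -/
def homogeneousPart (B : Module.Basis V (Poly k n) N) (deg : V → ℤ) (d : ℤ) : AddSubgroup N where
  carrier := {x | ∀ v m, (B.repr x v).coeff m ≠ 0 → (m.degree : ℤ) + deg v = d}
  zero_mem' v m h := by simp at h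
  add_mem' {x y} hx hy v m h := by
    rw [map_add, Finsupp.add_apply, MvPolynomial.coeff_add] at h
    by_cases h0 : (B.repr x v).coeff m = 0
    · exact hy v m (by rwa [h0, zero_add] at h)
    · exact hx v m h0
  neg_mem' {x} hx v m h := hx v m (by
    rwa [map_neg, Finsupp.neg_apply, MvPolynomial.coeff_neg, neg_ne_zero] at h)

lemma mem_homogeneousPart {B : Module.Basis V (Poly k n) N} {deg : V → ℤ} {d : ℤ} {x : N} :
    x ∈ homogeneousPart B deg d ↔
      ∀ v m, (B.repr x v).coeff m ≠ 0 → (m.degree : ℤ) + deg v = d := Iff.rfl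

lemma smul_mem_homogeneousPart {B : Module.Basis V (Poly k n) N} {deg : V → ℤ} {d e : ℤ}
    {p : Poly k n} {x : N} (hp : ∀ m, p.coeff m ≠ 0 → (m.degree : ℤ) + e = d)
    (hx : x ∈ homogeneousPart B deg e) : p • x ∈ homogeneousPart B deg d := by
  intro v m h
  rw [map_smul, Finsupp.smul_apply, smul_eq_mul, MvPolynomial.coeff_mul] at h
  obtain ⟨⟨a, c⟩, hmem, hne⟩ := Finset.exists_ne_zero_of_sum_ne_zero h
  have h1 := hp a (left_ne_zero_of_mul hne)
  have h2 := hx v c (right_ne_zero_of_mul hne)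
  rw [← Finset.HasAntidiagonal.mem_antidiagonal.mp hmem, map_add]
  push_cast
  omega

lemma basis_mem_homogeneousPart (B : Module.Basis V (Poly k n) N) (deg : V → ℤ) (v : V) :
    B v ∈ homogeneousPart B deg (deg v) := by
  classical
  intro w m h
  rw [B.repr_self, Finsupp.single_apply] at h
  split_ifs at h with hvw
  · subst hvw
    rw [MvPolynomial.coeff_one] at h
    obtain rfl : 0 = m := by by_contra hne; simp [hne] at h
    simp
  · simp at h

/-- Asking for `hf` only at basis elements that occur in `x` makes this usable as an induction step
along `vtxLT`. -/
lemma map_mem_homogeneousPart {B : Module.Basis V (Poly k n) N}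
    {B' : Module.Basis V' (Poly k n) N'} {deg : V → ℤ} {deg' : V' → ℤ} {d : ℤ}
    (f : N →ₗ[Poly k n] N') {x : N} (hx : x ∈ homogeneousPart B deg d)
    (hf : ∀ v, B.repr x v ≠ 0 → f (B v) ∈ homogeneousPart B' deg' (deg v)) :
    f x ∈ homogeneousPart B' deg' d := by
  rw [← B.linearCombination_repr x, Finsupp.linearCombination_apply, Finsupp.sum, map_sum]
  refine AddSubgroup.sum_mem _ fun v hv => ?_
  rw [map_smul]
  exact smul_mem_homogeneousPart (fun m hm => hx v m hm) (hf v (Finsupp.mem_support_iff.mp hv))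

end Homogeneous

/-! ### Homogeneity of the Morse complex -/

section Main

variable {k : Type*} [Field k] {n : ℕ} {ι : Type*}
  {M : Type*} [AddCommGroup M] [Module k M] [Module (Poly k n) M]
  [IsScalarTower k (Poly k n) M]
  {ord : TermOrder n ι} {η : (ι →₀ Poly k n) →ₗ[Poly k n] M}
  {b : Module.Basis (StdTerm ord η) k M} {ℳ : ℤ → Submodule k M} {deg : ι → ℤ}

/-- The internal degree `|I| + |α| + deg g_j` of `e_I x^α g_j`. -/
def vertexDeg (deg : ι → ℤ) (p : ℕ) (v : Vertex ord η p) : ℤ :=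
  p + v.2.1.1.degree + deg v.2.1.2

lemma elemE_mem_homogeneousPart (hℳ : IsGrading (n := n) ℳ)
    (hb : ∀ t, b t = η (termVec k t.1)) (hdeg : ∀ j, η (Finsupp.single j 1) ∈ ℳ (deg j))
    (p : ℕ) (I : Finset (Fin n)) {d : ℤ} {m : M} (hm : m ∈ ℳ d) :
    elemE k n p I m ∈ homogeneousPart (koszulBasis b p) (vertexDeg deg p) (p + d) := by
  classical
  intro w a h
  rw [koszulBasis_repr_elemE] at h
  split_ifs at h with hI
  · rw [MvPolynomial.coeff_C] at h
    split_ifs at h with ha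
    · have := repr_degree hℳ hb hdeg hm h
      rw [← ha, vertexDeg, ← this]
      simp only [map_zero, Nat.cast_zero, zero_add, add_assoc]
    · exact absurd rfl h
  · simp at h

lemma apply_mem_vertexDeg (hℳ : IsGrading (n := n) ℳ)
    (hb : ∀ t, b t = η (termVec k t.1)) (hdeg : ∀ j, η (Finsupp.single j 1) ∈ ℳ (deg j))
    (t : StdTerm ord η) : b t ∈ ℳ (t.1.1.degree + deg t.1.2) :=
  hb t ▸ apply_termVec_mem hℳ hdeg t.1

lemma koszulD_mem_homogeneousPart (hℳ : IsGrading (n := n) ℳ)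
    (hb : ∀ t, b t = η (termVec k t.1)) (hdeg : ∀ j, η (Finsupp.single j 1) ∈ ℳ (deg j))
    (p : ℕ) (v : Vertex ord η (p + 1)) :
    koszulD k n M p (koszulBasis b (p + 1) v) ∈
      homogeneousPart (koszulBasis b p) (vertexDeg deg p) (vertexDeg deg (p + 1) v) := by
  have hm := apply_mem_vertexDeg hℳ hb hdeg v.2
  rw [koszulBasis_apply, koszulD_elemE]
  refine AddSubgroup.sum_mem _ fun i _ => zsmul_mem (sub_mem ?_ ?_) _
  · refine smul_mem_homogeneousPart (fun m h => ?_) (elemE_mem_homogeneousPart hℳ hb hdeg p _ hm)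
    classical
    rw [MvPolynomial.coeff_X] at h
    obtain rfl : Finsupp.single i 1 = m := by by_contra hne; simp [hne] at h
    rw [vertexDeg, Finsupp.degree_single]
    push_cast
    ring
  · have := elemE_mem_homogeneousPart hℳ hb hdeg p (v.1.1.erase i) (hℳ.X_smul_mem _ i _ hm)
    convert this using 2
    rw [vertexDeg]
    push_cast
    ring

lemma phiZero_mem_homogeneousPart (hb : ∀ t, b t = η (termVec k t.1)) (deg : ι → ℤ) {p : ℕ}
    {v : Vertex ord η p} {i : Fin n} (h : IsLiftIndex ord η v.1.1 v.2.1 i) :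
    phiZero η p v.1.1 v.2.1 i ∈
      homogeneousPart (koszulBasis b (p + 1)) (vertexDeg deg (p + 1)) (vertexDeg deg p v) := by
  have hd : vertexDeg deg p v = vertexDeg deg (p + 1) (liftVertex v i h.notMem) := by
    -- Moving `x_i` from the monomial into `I` preserves `|I| + |α|`.
    have := congrArg Finsupp.degree (sub_single_add_single (α := v.2.1.1) h.1.1)
    rw [map_add, Finsupp.degree_single] at this
    simp only [vertexDeg, liftVertex, StdTerm.divX]
    rw [← this]
    push_cast
    ring
  rw [phiZero_eq hb h, hd]
  exact neg_mem (zsmul_mem (basis_mem_homogeneousPart (koszulBasis b (p + 1)) _ _) _)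

lemma IsMorseHomotopy.mem_homogeneousPart [Finite ι] (hℳ : IsGrading (n := n) ℳ)
    (hb : ∀ t, b t = η (termVec k t.1)) (hdeg : ∀ j, η (Finsupp.single j 1) ∈ ℳ (deg j))
    {φ : ∀ p, Koszul k n M p →ₗ[Poly k n] Koszul k n M (p + 1)}
    (hφ : IsMorseHomotopy ord η φ) (p : ℕ) (v : Vertex ord η p) :
    φ p (koszulBasis b p v) ∈
      homogeneousPart (koszulBasis b (p + 1)) (vertexDeg deg (p + 1)) (vertexDeg deg p v) := by
  have hrec := (isMorseHomotopy_iff hb).mp hφ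
  induction v using (vtxLT_wellFounded ord η p).induction with
  | _ v ih =>
  by_cases h : ∃ i, IsLiftIndex ord η v.1.1 v.2.1 i
  · obtain ⟨i, hi⟩ := h
    have hzero := phiZero_mem_homogeneousPart hb deg hi
    rw [hrec.1 p v i hi]
    refine sub_mem hzero (map_mem_homogeneousPart (B := koszulBasis b p)
      (deg := vertexDeg deg p) (φ p) (sub_mem ?_ ?_)
      fun w hw => ih w (vtxLT_of_repr_phiZero hb hi hw))
    · exact map_mem_homogeneousPart _ hzero fun w _ => koszulD_mem_homogeneousPart hℳ hb hdeg p w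
    · exact basis_mem_homogeneousPart (koszulBasis b p) _ _
  · rw [hrec.2 p v h]
    exact zero_mem _

lemma projG_mem_homogeneousPart (deg : ι → ℤ) (p : ℕ) (v : Vertex ord η p) :
    projG ord η b p (koszulBasis b p v) ∈
      homogeneousPart Finsupp.basisSingleOne (degG ord η deg p) (vertexDeg deg p v) := by
  by_cases h : ncritSet ⟨p, v⟩ = ∅
  · obtain ⟨c, rfl⟩ := exists_critCell h
    have hd : vertexDeg deg p c.vertex = degG ord η deg p c := by
      simp [vertexDeg, degG, CritCell.vertex]
    rw [projG_basis_vertex, hd]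
    have := basis_mem_homogeneousPart (k := k) (n := n)
      (Finsupp.basisSingleOne (ι := CritCell ord η p)) (degG ord η deg p) c
    rwa [Finsupp.coe_basisSingleOne] at this
  · rw [projG_basis_eq_zero h]
    exact zero_mem _

lemma diffG_single_mem_homogeneousPart [Finite ι] (hℳ : IsGrading (n := n) ℳ)
    (hb : ∀ t, b t = η (termVec k t.1)) (hdeg : ∀ j, η (Finsupp.single j 1) ∈ ℳ (deg j))
    {φ : ∀ p, Koszul k n M p →ₗ[Poly k n] Koszul k n M (p + 1)}
    (hφ : IsMorseHomotopy ord η φ) (p : ℕ) (c : CritCell ord η (p + 1)) :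
    diffG ord η b φ p (Finsupp.single c 1) ∈
      homogeneousPart Finsupp.basisSingleOne (degG ord η deg p) (degG ord η deg (p + 1) c) := by
  have hd : degG ord η deg (p + 1) c = vertexDeg deg (p + 1) c.vertex := by
    simp [vertexDeg, degG, CritCell.vertex]
  have h1 := koszulD_mem_homogeneousPart hℳ hb hdeg p c.vertex
  rw [hd, diffG, LinearMap.comp_apply, LinearMap.comp_apply, inclG_single hb,
    LinearMap.sub_apply, LinearMap.comp_apply, LinearMap.comp_apply]
  refine map_mem_homogeneousPart (B := koszulBasis b p) (deg := vertexDeg deg p) _ (sub_mem h1 ?_)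
    fun v _ => projG_mem_homogeneousPart deg p v
  refine map_mem_homogeneousPart (B := koszulBasis b (p + 1)) (deg := vertexDeg deg (p + 1)) _ ?_
    fun v _ => koszulD_mem_homogeneousPart hℳ hb hdeg p v
  exact map_mem_homogeneousPart _ h1 fun v _ => hφ.mem_homogeneousPart hℳ hb hdeg p v

/-! ### Minimality -/

/-- The coefficient at a vertex with `α = 0` can come from `x_i e_{I ∖ i} m` only, since the
expansion of `x_i m` contains no bare `g_j`. -/
lemma repr_koszulD_mem_irrelevant (hlin : InitiallyLinear ord η)
    (hb : ∀ t, b t = η (termVec k t.1)) {p : ℕ} (x : Koszul k n M (p + 1))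
    {w : Vertex ord η p} (hw : w.2.1.1 = 0) :
    (koszulBasis b p).repr (koszulD k n M p x) w ∈ irrelevant k n := by
  classical
  suffices ⊤ ≤ Submodule.comap ((koszulBasis b p).coord w ∘ₗ koszulD k n M p) (irrelevant k n) from
    this (x := x) trivial
  rw [← (koszulBasis b (p + 1)).span_eq, Submodule.span_le]
  rintro _ ⟨v, rfl⟩
  change (koszulBasis b p).repr (koszulD k n M p (koszulBasis b (p + 1) v)) w ∈ irrelevant k n
  rw [koszulBasis_apply, koszulBasis_repr_koszulD]
  refine Submodule.sum_mem _ fun i _ => zsmul_mem ?_ _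
  split_ifs
  · have h0 : b.repr ((MvPolynomial.X i : Poly k n) • b v.2) w.2 = 0 := by
      by_contra hne
      rw [hb, X_smul_apply_termVec] at hne
      refine repr_ne_zero_term hlin hb ?_ hne hw
      intro h
      simpa using DFunLike.congr_fun h i
    rw [h0, MvPolynomial.C_0, sub_zero]
    exact Ideal.mul_mem_right _ _ (Ideal.subset_span ⟨i, rfl⟩)
  · exact zero_mem _

lemma projG_apply {p : ℕ} (x : Koszul k n M p) (c : CritCell ord η p) :
    projG ord η b p x c = (koszulBasis b p).repr x c.vertex := by
  suffices Finsupp.lapply c ∘ₗ projG ord η b p = (koszulBasis b p).coord c.vertex from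
    LinearMap.congr_fun this x
  refine (koszulBasis b p).ext fun v => ?_
  rw [LinearMap.comp_apply, Module.Basis.coord_apply, Module.Basis.repr_self, Finsupp.lapply_apply]
  have hinj (c c' : CritCell ord η p) (h : c.vertex = c'.vertex) : c = c' := by
    refine Subtype.ext (Prod.ext ?_ ?_)
    · exact congrArg (fun v : Vertex ord η p => v.1.1) h
    · exact congrArg (fun v : Vertex ord η p => v.2.1.2) h
  by_cases h : ncritSet ⟨p, v⟩ = ∅
  · obtain ⟨c', rfl⟩ := exists_critCell h
    rw [projG_basis_vertex]
    by_cases hc : c = c'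
    · rw [hc, Finsupp.single_eq_same, Finsupp.single_eq_same]
    · rw [Finsupp.single_eq_of_ne hc, Finsupp.single_eq_of_ne fun h => hc (hinj _ _ h)]
  · rw [projG_basis_eq_zero h, Finsupp.single_eq_of_ne, Finsupp.zero_apply]
    rintro rfl
    exact h c.ncritSet_vertex

lemma augG_eq (ord : TermOrder n ι) (η : (ι →₀ Poly k n) →ₗ[Poly k n] M) :
    augG ord η = koszulAug k n M ∘ₗ inclG ord η 0 := by
  refine Finsupp.basisSingleOne.ext fun c => ?_
  rw [Finsupp.coe_basisSingleOne, LinearMap.comp_apply, inclG, augG,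
    Finsupp.linearCombination_single, Finsupp.linearCombination_single, one_smul, one_smul, elemE,
    koszulAug_inclE k n M _ c.2.1, one_smul]

/-- The Morse complex of the two-sided Koszul complex is the minimal graded free resolution. -/
theorem IsMorseHomotopy.isMinimalGradedFreeResolution [Finite ι] (hℳ : IsGrading (n := n) ℳ)
    (hlin : InitiallyLinear ord η) (hb : ∀ t, b t = η (termVec k t.1))
    (hdeg : ∀ j, η (Finsupp.single j 1) ∈ ℳ (deg j))
    {φ : ∀ p, Koszul k n M p →ₗ[Poly k n] Koszul k n M (p + 1)}
    (hφ : IsMorseHomotopy ord η φ) :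
    IsMinimalGradedFreeResolution ℳ (degG ord η deg) (diffG ord η b φ) (augG ord η) where
  isFreeResolution := by
    rw [augG_eq]
    exact (hφ.isMorseSplitting hb).isFreeResolution (koszul_isFreeResolution k n M)
      fun p => inferInstance
  finite p := Subtype.finite
  homogeneous_aug c := by
    rw [augG, Finsupp.linearCombination_single, one_smul, degG, Nat.cast_zero, zero_add]
    exact hdeg _
  homogeneous p c c' hne := by
    have hmem := InitLin.mem_homogeneousPart.mp (diffG_single_mem_homogeneousPart hℳ hb hdeg hφ p c) c'
    obtain ⟨m, hm⟩ := MvPolynomial.ne_zero_iff.mp hne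
    -- All monomials of the entry have the same degree, namely the difference of the degrees of the
    -- two cells.
    refine ⟨m.degree, fun a ha => ?_, hmem m hm⟩
    have h1 := hmem m hm
    have h2 := hmem a ha
    rw [show (1 : Fin n → ℕ) = fun _ => 1 from rfl, ← Finsupp.degree_eq_weight_one]
    have : (a.degree : ℤ) = m.degree := by linarith
    exact_mod_cast this
  minimal p := by
    rintro _ ⟨g, rfl⟩
    refine mem_smul_top_of_apply_mem fun c => ?_
    -- As `d - d φ d = d (1 - φ d)`, the coefficient is one of a boundary in `F`.
    rw [diffG, LinearMap.comp_apply, projG_apply, LinearMap.comp_apply, LinearMap.sub_apply,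
      LinearMap.comp_apply, ← map_sub]
    exact repr_koszulD_mem_irrelevant hlin hb _ rfl

end Main

end InitLin

end

theorem mainTheorem1 {k : Type*} [Field k] {n : ℕ} {ι : Type*} [Finite ι]
    {M : Type*} [AddCommGroup M] [Module k M] [Module (InitLin.Poly k n) M]
    [IsScalarTower k (InitLin.Poly k n) M]
    (ℳ : ℤ → Submodule k M) (hℳ : InitLin.IsGrading (n := n) ℳ)
    (η : (ι →₀ InitLin.Poly k n) →ₗ[InitLin.Poly k n] M) (hη : Function.Surjective η)
    (deg : ι → ℤ) (hdeg : ∀ j, η (Finsupp.single j 1) ∈ ℳ (deg j))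
    (ord : InitLin.TermOrder n ι) (hlin : InitLin.InitiallyLinear ord η) :
    InitLin.IsFreeResolution (R := InitLin.Poly k n) (K := InitLin.Koszul k n M)
      (InitLin.koszulD k n M) (InitLin.koszulAug k n M) ∧
    ∃ b : Module.Basis (InitLin.StdTerm ord η) k M,
      (∀ t, b t = η (InitLin.termVec k t.1)) ∧
      InitLin.IsMorseMatching (R := InitLin.Poly k n) (K := InitLin.Koszul k n M)
        (V := InitLin.Vertex ord η)
        (InitLin.koszulD k n M) (InitLin.koszulBasis b) (InitLin.Matching ord η) ∧
      (∀ (p : ℕ) (v : InitLin.Vertex ord η p),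
        InitLin.IsUnmatched (InitLin.Matching ord η) ⟨p, v⟩ ↔
          v.2.1.1 = 0 ∧ ∀ i ∈ v.1.1, i ∈ InitLin.crit ord η v.2.1.2) ∧
      ∃ φ : ∀ p, InitLin.Koszul k n M p →ₗ[InitLin.Poly k n] InitLin.Koszul k n M (p + 1),
        InitLin.IsMorseHomotopy ord η φ ∧
        (∀ ψ : ∀ p, InitLin.Koszul k n M p →ₗ[InitLin.Poly k n] InitLin.Koszul k n M (p + 1),
          InitLin.IsMorseHomotopy ord η ψ → ψ = φ) ∧
        InitLin.IsMinimalGradedFreeResolution ℳ (InitLin.degG ord η deg)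
          (InitLin.diffG ord η b φ) (InitLin.augG ord η) := by
  obtain ⟨b, hb⟩ := hlin.exists_basis hη
  have hφ := InitLin.isMorseHomotopy_morseHomotopy hb
  exact ⟨InitLin.koszul_isFreeResolution k n M, b, hb, InitLin.isMorseMatching hb,
    fun _ => InitLin.isUnmatched_iff, InitLin.morseHomotopy b, hφ, fun _ hψ => hφ.unique hb hψ,
    hφ.isMinimalGradedFreeResolution hℳ hlin hb hdeg⟩
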